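/- Let $\mathcal G$ be a finite non-empty set and $K:\mathcal G\times\mathcal G\to[0,\infty)$ symmetric, such that any two vertices are joined by a path $g_0,\dots,g_m$ with $K(g_l,g_{l+1})>0$ for all $l$. Let $\mathcal P_2(\mathbb R^d\times\mathcal G)$ be the set of Borel probability measures on $\mathbb R^d\times\mathcal G$ with finite second moment. Let $\theta:\mathbb R^d\times\mathcal G\times\mathcal G\times[0,\infty)\times[0,\infty)\to[0,\infty)$, written $\theta_{x,g,g'}(s,t)$, be Borel measurable and satisfy one of the following. **(A0)** $\theta_{x,g,g'}(s,t)=\theta_{x,g,g'}$ does not depend on $s,t$; $\theta_{x,g,g'}=\theta_{x,g',g}$; for each compact $C\subset\mathbb R^d$ there is $c>0$ with $\theta_{x,g,g'}\ge c$ for all $x\in C$, $g,g'\in\mathcal G$; and $x\mapsto\theta_{x,g,g'}$ is locally integrable for all $g,g'$. **(A1)–(A5)** (A1) $\theta_{x,g,g'}(s,t)=\theta_{x,g,g'}(t,s)$; (A2) $\theta_{x,g,g'}(\cdot,\cdot)$ is differentiable on $(0,\infty)^2$; (A3) $\theta_{x,g,g'}(r,t)\le\theta_{x,g,g'}(s,t)$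 for $r\le s$; (A4) $\theta_{x,g,g'}(\lambda s,\lambda t)=\lambda\theta_{x,g,g'}(s,t)$ for $\lambda\ge0$; (A5) on each compact subset of $\mathbb R^d\times\mathcal G\times\mathcal G$ the quantity $\int_0^1\theta_{x,g,g'}(1-t,t)^{-1/2}\,dt$ is bounded above by a finite constant, and $\theta_{x,g,g'}(1,1)$ is bounded away from zero; moreover $\theta_{x,g,g'}(1,1)$ is bounded above on each such compact set. For $\mu\in\mathcal P_2(\mathbb R^d\times\mathcal G)$ let $\hat\mu$ be the measure on $\mathbb R^d\times\mathcal G\times\mathcal G$ given by $d\hat\mu=\theta_{x,g,g'}\,dx\,dg\,dg'$ under (A0), and by $d\hat\mu=\theta_{x,g,g'}(\mu_{g|x}(g),\mu_{g|x}(g'))\,d\mu_x(x)\,dg\,dg'$ under (A1)–(A5). Here $\mu_x$ is the first marginal of $\mu$, $\mu_{g|x}$ is the conditional distribution of $g$ given $x$, and $dg$ is the counting measure on $\mathcal G$. For $\psi:\mathbb R^d\times\mathcal G\to\mathbb R$ put $\nabla_g\psi(x,g,g')=\psi(x,g')-\psi(x,g)$. A curve $t\in[0,1]\mapsto\mu_t\in\mathcal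 P_2(\mathbb R^d\times\mathcal G)$, together with fields $v_t:\mathbb R^d\times\mathcal G\to\mathbb R^d$ and $h_t:\mathbb R^d\times\mathcal G\times\mathcal G\to\mathbb R$ that are Borel in $(t,x)$, solves the semi-discrete continuity equation if for every $\zeta$ with $\zeta(\cdot,g)\in C_c^\infty(\mathbb R^d)$ for all $g$, the function $t\mapsto\int\zeta\,d\mu_t$ is absolutely continuous on $[0,1]$ and, for a.e. $t$, $$\frac{d}{dt}\int\zeta\,d\mu_t=\int\nabla_x\zeta\cdot v_t\,d\mu_t+\int\nabla_g\zeta(x,g,g')\,h_t(x,g,g')\,K(g,g')\,d\hat\mu_t(x,g,g'),$$ where for a.e. $t$ both integrands on the right are integrable. For $\mu_0,\mu_1\in\mathcal P_2(\mathbb R^d\times\mathcal G)$ define $$W_2(\mu_0,\mu_1)^2:=\inf\int_0^1\Big(\int|\nabla_x\phi_t|^2\,d\mu_t+\int(\nabla_g\psi_t(x,g,g'))^2K(g,g')\,d\hat\mu_t(x,g,g')\Big)dt,$$ the infimum being over all solutions of the form $t\in[0,1]\mapsto(\mu_t,\nabla_x\phi_t,\nabla_g\psi_t)$ joining $\mu_0$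 to $\mu_1$, with $\phi_t,\psi_t:\mathbb R^d\times\mathcal G\to\mathbb R$ and $\phi_t(\cdot,g)$ differentiable for all $t,g$. Then $W_2$ is a metric on $\mathcal P_2(\mathbb R^d\times\mathcal G)$: for all $\mu,\nu,\rho\in\mathcal P_2(\mathbb R^d\times\mathcal G)$, $W_2(\mu,\nu)<\infty$; $W_2(\mu,\nu)=0$ if and only if $\mu=\nu$; $W_2(\mu,\nu)=W_2(\nu,\mu)$; and $W_2(\mu,\rho)\le W_2(\mu,\nu)+W_2(\nu,\rho)$. -/

import Mathlib

open MeasureTheory Set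
open scoped ENNReal NNReal

noncomputable section

namespace SemiDiscrete

/-- Euclidean space `ℝ^d`. -/
abbrev Euc (d : ℕ) : Type := EuclideanSpace ℝ (Fin d)

/-- Borel probability measures on `ℝ^d × G` with finite second moment (`G` is finite, so only the
`ℝ^d`-component matters for the moment). -/
def P2 (d : ℕ) (G : Type*) [MeasurableSpace G] : Type _ :=
  {μ : Measure (Euc d × G) // IsProbabilityMeasure μ ∧ ∫⁻ p, ‖p.1‖ₑ ^ 2 ∂μ < ⊤}

instance {d : ℕ} {G : Type*} [MeasurableSpace G] (μ : P2 d G) : IsProbabilityMeasure μ.1 := μ.2.1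

/-- `(G, K)` is a connected weighted graph: `K` is symmetric and nonnegative, and any two vertices
are joined by a path along edges of positive weight. -/
structure IsConnectedWeightedGraph {G : Type*} (K : G → G → ℝ) : Prop where
  symm : ∀ g g', K g g' = K g' g
  nonneg : ∀ g g', 0 ≤ K g g'
  connected : ∀ g g', Relation.ReflTransGen (fun a b => 0 < K a b) g g'

/-- The mobility `θ_{x,g,g'}(s,t)` does not depend on the masses `s, t ≥ 0`. -/
def MassIndependent {d : ℕ} {G : Type*} (θ : Euc d → G → G → ℝ → ℝ → ℝ) : Prop :=
  ∀ x g g' s t s' t', 0 ≤ s → 0 ≤ t → 0 ≤ s' → 0 ≤ t' → θ x g g' s t = θ x g g' s' t'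

/-- Nonnegative Borel mobility `θ : ℝ^d × G × G × [0,∞) × [0,∞) → [0,∞)`. -/
structure IsMobility {d : ℕ} {G : Type*} (θ : Euc d → G → G → ℝ → ℝ → ℝ) : Prop where
  nonneg : ∀ x g g' s t, 0 ≤ s → 0 ≤ t → 0 ≤ θ x g g' s t
  measurable : ∀ g g', Measurable fun p : Euc d × ℝ≥0 × ℝ≥0 => θ p.1 g g' p.2.1 p.2.2

/-- Assumption (A0). The first three fields are the assumption itself; the last one says that
`θ_{x,g,g'} dx` is a locally finite measure. -/
structure AssumptionA0 {d : ℕ} {G : Type*} (θ : Euc d → G → G → ℝ → ℝ → ℝ) : Prop where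
  massIndependent : MassIndependent θ
  symm : ∀ x g g' s t, 0 ≤ s → 0 ≤ t → θ x g g' s t = θ x g' g s t
  boundedBelow : ∀ C : Set (Euc d), IsCompact C →
    ∃ c : ℝ, 0 < c ∧ ∀ x ∈ C, ∀ g g', c ≤ θ x g g' 1 1
  locallyIntegrable : ∀ g g', LocallyIntegrable (fun x => θ x g g' 1 1) volume

/-- Assumptions (A1)-(A5), together with (last field) an upper bound of `θ_{x,g,g'}(1,1)` on compact
sets. -/
structure AssumptionA1A5 {d : ℕ} {G : Type*} (θ : Euc d → G → G → ℝ → ℝ → ℝ) : Prop where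
  symm : ∀ x g g' s t, 0 ≤ s → 0 ≤ t → θ x g g' s t = θ x g g' t s
  differentiable : ∀ x g g',
    DifferentiableOn ℝ (fun p : ℝ × ℝ => θ x g g' p.1 p.2) (Ioi 0 ×ˢ Ioi 0)
  mono : ∀ x g g' r s t, 0 ≤ r → r ≤ s → 0 ≤ t → θ x g g' r t ≤ θ x g g' s t
  homogeneous : ∀ x g g' l s t, 0 ≤ l → 0 ≤ s → 0 ≤ t →
    θ x g g' (l * s) (l * t) = l * θ x g g' s t
  integralBound : ∀ C : Set (Euc d), IsCompact C → ∃ M : ℝ≥0, ∀ x ∈ C, ∀ g g',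
    ∫⁻ t in Icc (0 : ℝ) 1, (ENNReal.ofReal (√(θ x g g' (1 - t) t)))⁻¹ ≤ M
  boundedBelow : ∀ C : Set (Euc d), IsCompact C →
    ∃ c : ℝ, 0 < c ∧ ∀ x ∈ C, ∀ g g', c ≤ θ x g g' 1 1
  locallyBounded : ∀ C : Set (Euc d), IsCompact C →
    ∃ M : ℝ, ∀ x ∈ C, ∀ g g', θ x g g' 1 1 ≤ M

open Classical in
/-- The slice at `(g,g')` of the measure `μ̂` on `ℝ^d × G × G`: it is `θ_{x,g,g'} dx` for a mass
independent mobility, and `θ_{x,g,g'}(μ_{g|x}(g), μ_{g|x}(g')) dμ_x(x)` otherwise, where `μ_x` is the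
first marginal of `μ` and `μ_{g|x}` the conditional distribution of `g` given `x`. -/
def hat {d : ℕ} {G : Type*} [Finite G] [Nonempty G] [MeasurableSpace G]
    [DiscreteMeasurableSpace G] (θ : Euc d → G → G → ℝ → ℝ → ℝ) (μ : P2 d G) (g g' : G) :
    Measure (Euc d) :=
  if MassIndependent θ then volume.withDensity fun x => ENNReal.ofReal (θ x g g' 1 1)
  else μ.1.fst.withDensity fun x =>
    ENNReal.ofReal (θ x g g' ((μ.1.condKernel x).real {g}) ((μ.1.condKernel x).real {g'}))

/-- The gradient `∇_x φ (x,g)`. -/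
def gradX {d : ℕ} {G : Type*} (φ : Euc d → G → ℝ) (x : Euc d) (g : G) : Euc d :=
  gradient (fun y => φ y g) x

/-- The discrete gradient `∇_g ψ (x,g,g')`. -/
def gradG {d : ℕ} {G : Type*} (ψ : Euc d → G → ℝ) (x : Euc d) (g g' : G) : ℝ :=
  ψ x g' - ψ x g

/-- Test functions `ζ ∈ C_c^∞(ℝ^d × G)`. -/
structure IsTest {d : ℕ} {G : Type*} (ζ : Euc d → G → ℝ) : Prop where
  smooth : ∀ g, ContDiff ℝ (⊤ : ℕ∞) fun x => ζ x g
  compactSupport : ∀ g, HasCompactSupport fun x => ζ x g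

/-- Right-hand side of the semi-discrete continuity equation tested with `ζ`. -/
def ceRHS {d : ℕ} {G : Type*} [Fintype G] [Nonempty G] [MeasurableSpace G]
    [DiscreteMeasurableSpace G] (K : G → G → ℝ) (θ : Euc d → G → G → ℝ → ℝ → ℝ)
    (μ : P2 d G) (v : Euc d → G → Euc d) (h : Euc d → G → G → ℝ) (ζ : Euc d → G → ℝ) : ℝ :=
  ∫ p, inner ℝ (gradX ζ p.1 p.2) (v p.1 p.2) ∂μ.1
    + ∑ g, ∑ g', ∫ x, gradG ζ x g g' * h x g g' * K g g' ∂(hat θ μ g g')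

/-- `t ∈ [0,1] ↦ (μ_t, v_t, h_t)` solves the semi-discrete continuity equation. The fields are Borel
in `(t,x)`; for every test function `ζ` the integrals on the right-hand side exist for a.e. `t`, and
`t ↦ ∫ ζ dμ_t` is an antiderivative of the (integrable) right-hand side, i.e. it is absolutely
continuous and the equation `d/dt ∫ ζ dμ_t = …` holds for a.e. `t`. Values of `μ, v, h` at times
outside `[0,1]` play no role (extend the fields by `0`). -/
structure SolvesCE {d : ℕ} {G : Type*} [Fintype G] [Nonempty G] [MeasurableSpace G]
    [DiscreteMeasurableSpace G] (K : G → G → ℝ) (θ : Euc d → G → G → ℝ → ℝ → ℝ)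
    (μ : ℝ → P2 d G) (v : ℝ → Euc d → G → Euc d) (h : ℝ → Euc d → G → G → ℝ) : Prop where
  measurable_v : ∀ g, Measurable fun p : ℝ × Euc d => v p.1 p.2 g
  measurable_h : ∀ g g', Measurable fun p : ℝ × Euc d => h p.1 p.2 g g'
  integrable_v : ∀ ζ : Euc d → G → ℝ, IsTest ζ → ∀ᵐ t ∂(volume.restrict (Icc (0 : ℝ) 1)),
    Integrable (fun p : Euc d × G => inner ℝ (gradX ζ p.1 p.2) (v t p.1 p.2)) (μ t).1
  integrable_h : ∀ ζ : Euc d → G → ℝ, IsTest ζ → ∀ᵐ t ∂(volume.restrict (Icc (0 : ℝ) 1)),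
    ∀ g g', Integrable (fun x => gradG ζ x g g' * h t x g g' * K g g') (hat θ (μ t) g g')
  integrable_rhs : ∀ ζ : Euc d → G → ℝ, IsTest ζ →
    IntervalIntegrable (fun t => ceRHS K θ (μ t) (v t) (h t) ζ) volume 0 1
  equation : ∀ ζ : Euc d → G → ℝ, IsTest ζ → ∀ t ∈ Icc (0 : ℝ) 1,
    ∫ p, ζ p.1 p.2 ∂(μ t).1 - ∫ p, ζ p.1 p.2 ∂(μ 0).1
      = ∫ r in (0 : ℝ)..t, ceRHS K θ (μ r) (v r) (h r) ζ

/-- Total kinetic energy of `t ∈ [0,1] ↦ (μ_t, v_t, h_t)`. -/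
def kineticEnergy {d : ℕ} {G : Type*} [Fintype G] [Nonempty G] [MeasurableSpace G]
    [DiscreteMeasurableSpace G] (K : G → G → ℝ) (θ : Euc d → G → G → ℝ → ℝ → ℝ)
    (μ : ℝ → P2 d G) (v : ℝ → Euc d → G → Euc d) (h : ℝ → Euc d → G → G → ℝ) : ℝ≥0∞ :=
  ∫⁻ t in Icc (0 : ℝ) 1,
    (∫⁻ p, ‖v t p.1 p.2‖ₑ ^ 2 ∂(μ t).1
      + ∑ g, ∑ g', ∫⁻ x, ENNReal.ofReal (h t x g g' ^ 2 * K g g') ∂(hat θ (μ t) g g'))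

/-- `t ∈ [0,1] ↦ (μ_t, ∇_x φ_t, ∇_g ψ_t)` is a solution of the continuity equation driven by
potentials that joins `μ₀` to `μ₁`. The potentials `φ_t` are differentiable in `x`. -/
structure IsAdmissible {d : ℕ} {G : Type*} [Fintype G] [Nonempty G] [MeasurableSpace G]
    [DiscreteMeasurableSpace G] (K : G → G → ℝ) (θ : Euc d → G → G → ℝ → ℝ → ℝ)
    (μ₀ μ₁ : P2 d G) (μ : ℝ → P2 d G) (φ ψ : ℝ → Euc d → G → ℝ) : Prop where
  start : μ 0 = μ₀
  finish : μ 1 = μ₁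
  differentiable : ∀ t g, Differentiable ℝ fun x => φ t x g
  solves : SolvesCE K θ μ (fun t => gradX (φ t)) (fun t => gradG (ψ t))

/-- The squared distance `W_2(μ₀,μ₁)²`: the infimum of the kinetic energy. -/
def W2sq {d : ℕ} {G : Type*} [Fintype G] [Nonempty G] [MeasurableSpace G]
    [DiscreteMeasurableSpace G] (K : G → G → ℝ) (θ : Euc d → G → G → ℝ → ℝ → ℝ)
    (μ₀ μ₁ : P2 d G) : ℝ≥0∞ :=
  ⨅ (μ : ℝ → P2 d G) (φ : ℝ → Euc d → G → ℝ) (ψ : ℝ → Euc d → G → ℝ)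
    (_ : IsAdmissible K θ μ₀ μ₁ μ φ ψ),
    kineticEnergy K θ μ (fun t => gradX (φ t)) (fun t => gradG (ψ t))

/-- The semi-discrete distance `W_2`. -/
def W2 {d : ℕ} {G : Type*} [Fintype G] [Nonempty G] [MeasurableSpace G]
    [DiscreteMeasurableSpace G] (K : G → G → ℝ) (θ : Euc d → G → G → ℝ → ℝ → ℝ)
    (μ₀ μ₁ : P2 d G) : ℝ≥0∞ :=
  W2sq K θ μ₀ μ₁ ^ (1 / 2 : ℝ)

end SemiDiscrete

end

/-! Symmetry and the triangle inequality come from changing time. Running a solution at speed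
$\alpha$ multiplies both fields by $\alpha$ and the energy by $|\alpha|$. Reversal therefore costs
nothing, and running two curves on $[0,l]$ and $[l,1]$ costs $a^2/l+b^2/(1-l)$, which equals
$(a+b)^2$ at $l=a/(a+b)$ (`SolvesOn.affine`, `SolvesOn.concat`, `W2sq_triangle_split`).

Distance zero forces equality because the energy controls $\frac{d}{dt}\int\zeta\,d\mu_t$ through
Young's inequality (`enorm_ceRHS_le`). The constants depend on $\zeta$ alone: $\hat\mu$ has mass on
a compact set bounded uniformly in $\mu$ (`exists_hat_le`). Test functions then separate measures.

Finiteness is shown by routing every measure through one reference measure. The dilations $x\mapsto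
tx$ are driven by $|x|^2/(2t)$ and cost at most the second moment. At $t=0$ only the marginal on $G$
survives, so measures with equal $G$-marginal are at finite distance (`W2sq_lt_top_of_snd_eq`). It
remains to change that marginal for one convenient $\rho$, along $\rho\otimes p_t$ with
$p_t=(1-t^2)p+t^2u$ and $u$ uniform (`W2sq_prodP2_uniformWeights_lt_top`). For each $x$ the field
$\psi_t(x,\cdot)$ solves a Laplace equation on the graph with conductances $K\theta$. Its source is
of order $t$ and the conductances are at least of order $t^2K$, so the Poincaré inequality of the
connected graph bounds the energy uniformly in $t$. -/

noncomputable section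

namespace SemiDiscrete

/-! ### Linearity of the two gradients -/

section Gradients

variable {d : ℕ} {G : Type*}

lemma gradX_const_mul (c : ℝ) {φ : Euc d → G → ℝ} (hφ : ∀ g, Differentiable ℝ fun x => φ x g) :
    gradX (fun x g => c * φ x g) = fun x g => c • gradX φ x g := by
  ext1 x; ext1 g
  simp only [gradX, gradient]
  rw [fderiv_const_mul (hφ g x)]
  simp

lemma gradG_const_mul (c : ℝ) (ψ : Euc d → G → ℝ) :
    gradG (fun x g => c * ψ x g) = fun x g g' => c * gradG ψ x g g' := by
  funext x g g'
  simp only [gradG]; ring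

end Gradients

/-! ### Curves on arbitrary time intervals -/

section Curves

variable {d : ℕ} {G : Type*} [Fintype G] [Nonempty G] [MeasurableSpace G]
    [DiscreteMeasurableSpace G] {K : G → G → ℝ} {θ : Euc d → G → G → ℝ → ℝ → ℝ}

/-- The kinetic energy at a fixed time. -/
def energyDensity (K : G → G → ℝ) (θ : Euc d → G → G → ℝ → ℝ → ℝ) (μ : P2 d G)
    (v : Euc d → G → Euc d) (h : Euc d → G → G → ℝ) : ℝ≥0∞ :=
  ∫⁻ p, ‖v p.1 p.2‖ₑ ^ 2 ∂μ.1
    + ∑ g, ∑ g', ∫⁻ x, ENNReal.ofReal (h x g g' ^ 2 * K g g') ∂(hat θ μ g g')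

/-- The semi-discrete continuity equation driven by potentials, on the time interval `[a,b]`. -/
structure SolvesOn (K : G → G → ℝ) (θ : Euc d → G → G → ℝ → ℝ → ℝ) (a b : ℝ)
    (μ : ℝ → P2 d G) (φ ψ : ℝ → Euc d → G → ℝ) : Prop where
  differentiable : ∀ t g, Differentiable ℝ fun x => φ t x g
  measurable_v : ∀ g, Measurable fun p : ℝ × Euc d => gradX (φ p.1) p.2 g
  measurable_h : ∀ g g', Measurable fun p : ℝ × Euc d => gradG (ψ p.1) p.2 g g'
  integrable_v : ∀ ζ : Euc d → G → ℝ, IsTest ζ → ∀ᵐ t : ℝ, t ∈ Icc a b →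
    Integrable (fun p : Euc d × G => inner ℝ (gradX ζ p.1 p.2) (gradX (φ t) p.1 p.2)) (μ t).1
  integrable_h : ∀ ζ : Euc d → G → ℝ, IsTest ζ → ∀ᵐ t : ℝ, t ∈ Icc a b →
    ∀ g g', Integrable (fun x => gradG ζ x g g' * gradG (ψ t) x g g' * K g g') (hat θ (μ t) g g')
  integrable_rhs : ∀ ζ : Euc d → G → ℝ, IsTest ζ →
    IntegrableOn (fun t => ceRHS K θ (μ t) (gradX (φ t)) (gradG (ψ t)) ζ) (Icc a b)
  equation : ∀ ζ : Euc d → G → ℝ, IsTest ζ → ∀ s ∈ Icc a b, ∀ t ∈ Icc a b,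
    ∫ p, ζ p.1 p.2 ∂(μ t).1 - ∫ p, ζ p.1 p.2 ∂(μ s).1
      = ∫ r in s..t, ceRHS K θ (μ r) (gradX (φ r)) (gradG (ψ r)) ζ

/-- The kinetic energy on the time interval `[a,b]`. -/
def energyOn (K : G → G → ℝ) (θ : Euc d → G → G → ℝ → ℝ → ℝ) (a b : ℝ)
    (μ : ℝ → P2 d G) (φ ψ : ℝ → Euc d → G → ℝ) : ℝ≥0∞ :=
  ∫⁻ t in Icc a b, energyDensity K θ (μ t) (gradX (φ t)) (gradG (ψ t))

lemma SolvesOn.isAdmissible {μ : ℝ → P2 d G} {φ ψ : ℝ → Euc d → G → ℝ}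
    (h : SolvesOn K θ 0 1 μ φ ψ) : IsAdmissible K θ (μ 0) (μ 1) μ φ ψ where
  start := rfl
  finish := rfl
  differentiable := h.differentiable
  solves :=
    { measurable_v := h.measurable_v
      measurable_h := h.measurable_h
      integrable_v := fun ζ hζ => (ae_restrict_iff' measurableSet_Icc).2 (h.integrable_v ζ hζ)
      integrable_h := fun ζ hζ => (ae_restrict_iff' measurableSet_Icc).2 (h.integrable_h ζ hζ)
      integrable_rhs := fun ζ hζ =>
        (intervalIntegrable_iff_integrableOn_Icc_of_le zero_le_one).2 (h.integrable_rhs ζ hζ)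
      equation := fun ζ hζ t ht => h.equation ζ hζ 0 (by simp) t ht }

lemma IsAdmissible.solvesOn {μ₀ μ₁ : P2 d G} {μ : ℝ → P2 d G} {φ ψ : ℝ → Euc d → G → ℝ}
    (h : IsAdmissible K θ μ₀ μ₁ μ φ ψ) : SolvesOn K θ 0 1 μ φ ψ where
  differentiable := h.differentiable
  measurable_v := h.solves.measurable_v
  measurable_h := h.solves.measurable_h
  integrable_v := fun ζ hζ => (ae_restrict_iff' measurableSet_Icc).1 (h.solves.integrable_v ζ hζ)
  integrable_h := fun ζ hζ => (ae_restrict_iff' measurableSet_Icc).1 (h.solves.integrable_h ζ hζ)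
  integrable_rhs := fun ζ hζ =>
    (intervalIntegrable_iff_integrableOn_Icc_of_le zero_le_one).1 (h.solves.integrable_rhs ζ hζ)
  equation := fun ζ hζ s hs t ht => by
    have hi : ∀ r ∈ Icc (0 : ℝ) 1, IntervalIntegrable
        (fun t => ceRHS K θ (μ t) (gradX (φ t)) (gradG (ψ t)) ζ) volume 0 r := fun r hr =>
      (h.solves.integrable_rhs ζ hζ).mono_set (by
        rw [uIcc_of_le hr.1, uIcc_of_le zero_le_one]; exact Icc_subset_Icc_right hr.2)
    rw [← intervalIntegral.integral_interval_sub_left (hi t ht) (hi s hs),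
      ← h.solves.equation ζ hζ t ht, ← h.solves.equation ζ hζ s hs]
    ring

lemma SolvesOn.W2sq_le {μ : ℝ → P2 d G} {φ ψ : ℝ → Euc d → G → ℝ}
    (h : SolvesOn K θ 0 1 μ φ ψ) : W2sq K θ (μ 0) (μ 1) ≤ energyOn K θ 0 1 μ φ ψ :=
  iInf_le_of_le μ <| iInf_le_of_le φ <| iInf_le_of_le ψ <| iInf_le_of_le h.isAdmissible le_rfl

lemma exists_solvesOn_of_W2sq_lt {μ₀ μ₁ : P2 d G} {c : ℝ≥0∞} (h : W2sq K θ μ₀ μ₁ < c) :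
    ∃ (μ : ℝ → P2 d G) (φ ψ : ℝ → Euc d → G → ℝ), SolvesOn K θ 0 1 μ φ ψ ∧ μ 0 = μ₀ ∧ μ 1 = μ₁ ∧
      energyOn K θ 0 1 μ φ ψ < c := by
  simp only [W2sq, iInf_lt_iff] at h
  obtain ⟨μ, φ, ψ, hadm, hlt⟩ := h
  exact ⟨μ, φ, ψ, hadm.solvesOn, hadm.start, hadm.finish, hlt⟩

/-! ### Affine changes of time -/

lemma ceRHS_smul (c : ℝ) (μ : P2 d G) (v : Euc d → G → Euc d) (h : Euc d → G → G → ℝ)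
    (ζ : Euc d → G → ℝ) :
    ceRHS K θ μ (fun x g => c • v x g) (fun x g g' => c * h x g g') ζ = c * ceRHS K θ μ v h ζ := by
  simp only [ceRHS, mul_add, Finset.mul_sum, ← integral_const_mul, inner_smul_right]
  congr 1
  refine Finset.sum_congr rfl fun g _ => Finset.sum_congr rfl fun g' _ => ?_
  congr 1; ext x; ring

lemma energyDensity_smul (c : ℝ) (μ : P2 d G) (v : Euc d → G → Euc d) (h : Euc d → G → G → ℝ) :
    energyDensity K θ μ (fun x g => c • v x g) (fun x g g' => c * h x g g')
      = ENNReal.ofReal (c ^ 2) * energyDensity K θ μ v h := by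
  simp only [energyDensity, mul_add, Finset.mul_sum,
    ← lintegral_const_mul' _ _ ENNReal.ofReal_ne_top]
  congr 1
  · congr 1; ext p
    rw [enorm_smul, mul_pow, ← sq_abs c, ENNReal.ofReal_pow (abs_nonneg c),
      Real.enorm_eq_ofReal_abs]
  · refine Finset.sum_congr rfl fun g _ => Finset.sum_congr rfl fun g' _ => ?_
    congr 1; ext x
    rw [← ENNReal.ofReal_mul (sq_nonneg c)]
    congr 1; ring

lemma map_volume_affine {α : ℝ} (hα : α ≠ 0) (β : ℝ) :
    Measure.map (fun t : ℝ => α * t + β) volume = ENNReal.ofReal |α⁻¹| • volume := by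
  have h : (fun t : ℝ => α * t + β) = (fun t => t + β) ∘ fun t => α * t := rfl
  rw [h, ← Measure.map_map (measurable_add_const β) (measurable_const_mul α),
    Real.map_volume_mul_left hα, Measure.map_smul, map_add_right_eq_self]

/-- The energy density is not known to be measurable in time; changing variables along an embedding
does not require it. -/
lemma measurableEmbedding_affine {α : ℝ} (hα : α ≠ 0) (β : ℝ) :
    MeasurableEmbedding fun t : ℝ => α * t + β :=
  (MeasurableEquiv.addRight β).measurableEmbedding.comp (measurableEmbedding_mulLeft₀ hα)

lemma ae_comp_affine {α : ℝ} (hα : α ≠ 0) (β : ℝ) {P : ℝ → Prop} (h : ∀ᵐ t : ℝ, P t) :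
    ∀ᵐ t : ℝ, P (α * t + β) := by
  have hq : Measure.QuasiMeasurePreserving (fun t : ℝ => α * t + β) volume volume :=
    ⟨(measurableEmbedding_affine hα β).measurable, by
      rw [map_volume_affine hα β]; exact Measure.smul_absolutelyContinuous⟩
  exact hq.ae h

/-- Chain rule: the time derivative gains a factor $\alpha$, and scaling the potentials by $\alpha$
supplies it. Negative $\alpha$ is allowed, which covers time reversal. -/
lemma SolvesOn.affine {a b a' b' α β : ℝ} (hα : α ≠ 0)
    (hm : ∀ t ∈ Icc a' b', α * t + β ∈ Icc a b)
    {μ : ℝ → P2 d G} {φ ψ : ℝ → Euc d → G → ℝ} (h : SolvesOn K θ a b μ φ ψ) :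
    SolvesOn K θ a' b' (fun t => μ (α * t + β)) (fun t x g => α * φ (α * t + β) x g)
      (fun t x g => α * ψ (α * t + β) x g) := by
  have hφ : ∀ t, gradX (fun x g => α * φ (α * t + β) x g)
      = fun x g => α • gradX (φ (α * t + β)) x g := fun t =>
    gradX_const_mul α (h.differentiable _)
  have hψ : ∀ t, gradG (fun x g => α * ψ (α * t + β) x g)
      = fun x g g' => α * gradG (ψ (α * t + β)) x g g' := fun t => gradG_const_mul α _
  have hmeas : Measurable fun p : ℝ × Euc d => (α * p.1 + β, p.2) := by fun_prop
  constructor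
  · exact fun t g => (h.differentiable _ g).const_mul α
  · intro g
    simp only [hφ]
    exact ((h.measurable_v g).comp hmeas).const_smul α
  · intro g g'
    simp only [hψ]
    exact ((h.measurable_h g g').comp hmeas).const_mul α
  · intro ζ hζ
    filter_upwards [ae_comp_affine hα β (h.integrable_v ζ hζ)] with t ht hmem
    simp only [hφ, inner_smul_right]
    exact (ht (hm t hmem)).const_mul α
  · intro ζ hζ
    filter_upwards [ae_comp_affine hα β (h.integrable_h ζ hζ)] with t ht hmem g g'
    simp only [hψ]
    refine ((ht (hm t hmem) g g').const_mul α).congr (ae_of_all _ fun x => ?_)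
    simp only; ring
  · intro ζ hζ
    simp only [hφ, hψ, ceRHS_smul]
    refine Integrable.const_mul ?_ α
    have h1 := (integrable_indicator_iff measurableSet_Icc).2 (h.integrable_rhs ζ hζ)
    have h2 : Integrable (fun t : ℝ => (Icc a b).indicator
        (fun t => ceRHS K θ (μ t) (gradX (φ t)) (gradG (ψ t)) ζ) (α * t + β)) := by
      have := (measurableEmbedding_affine hα β).integrable_map_iff (μ := volume)
        (g := (Icc a b).indicator (fun t => ceRHS K θ (μ t) (gradX (φ t)) (gradG (ψ t)) ζ))
      rw [map_volume_affine hα β] at this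
      exact this.1 (h1.smul_measure ENNReal.ofReal_ne_top)
    refine (h2.integrableOn (s := Icc a' b')).congr_fun (fun t ht => ?_) measurableSet_Icc
    simp only [indicator_of_mem (hm t ht)]
  · intro ζ hζ s hs t ht
    simp only [hφ, hψ, ceRHS_smul]
    rw [h.equation ζ hζ _ (hm s hs) _ (hm t ht), intervalIntegral.integral_const_mul,
      ← intervalIntegral.smul_integral_comp_mul_add
        (fun t => ceRHS K θ (μ t) (gradX (φ t)) (gradG (ψ t)) ζ) α β, smul_eq_mul]

/-- The squared fields give $\alpha^2$ and the substitution in time gives $|\alpha|^{-1}$. Only an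
inequality holds, since the image of $[a',b']$ may be smaller than $[a,b]$. -/
lemma energyOn_affine_le {a b a' b' α β : ℝ} (hα : α ≠ 0)
    (hm : ∀ t ∈ Icc a' b', α * t + β ∈ Icc a b)
    {μ : ℝ → P2 d G} {φ ψ : ℝ → Euc d → G → ℝ} (hφ : ∀ t g, Differentiable ℝ fun x => φ t x g) :
    energyOn K θ a' b' (fun t => μ (α * t + β)) (fun t x g => α * φ (α * t + β) x g)
      (fun t x g => α * ψ (α * t + β) x g) ≤ ENNReal.ofReal |α| * energyOn K θ a b μ φ ψ := by
  set e : ℝ → ℝ≥0∞ := fun t => energyDensity K θ (μ t) (gradX (φ t)) (gradG (ψ t)) with he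
  have h1 : ∫⁻ t in Icc a' b', e (α * t + β) ≤ ENNReal.ofReal |α⁻¹| * ∫⁻ t in Icc a b, e t := by
    calc ∫⁻ t in Icc a' b', e (α * t + β)
        ≤ ∫⁻ t : ℝ, (Icc a b).indicator e (α * t + β) := by
          rw [← lintegral_indicator measurableSet_Icc]
          refine lintegral_mono fun t => ?_
          by_cases ht : t ∈ Icc a' b'
          · simp [indicator_of_mem ht, indicator_of_mem (hm t ht)]
          · simp [indicator_of_notMem ht]
      _ = ENNReal.ofReal |α⁻¹| * ∫⁻ t in Icc a b, e t := by
          rw [← (measurableEmbedding_affine hα β).lintegral_map ((Icc a b).indicator e),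
            map_volume_affine hα β, lintegral_smul_measure, smul_eq_mul,
            lintegral_indicator measurableSet_Icc]
  have h2 : energyOn K θ a' b' (fun t => μ (α * t + β)) (fun t x g => α * φ (α * t + β) x g)
      (fun t x g => α * ψ (α * t + β) x g) = ENNReal.ofReal (α ^ 2) *
        ∫⁻ t in Icc a' b', e (α * t + β) := by
    rw [energyOn, ← lintegral_const_mul' _ _ ENNReal.ofReal_ne_top]
    congr 1; ext t
    rw [gradX_const_mul α (hφ _), gradG_const_mul α, energyDensity_smul]
  rw [h2]
  refine (mul_le_mul_right h1 _).trans_eq ?_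
  rw [← mul_assoc, ← ENNReal.ofReal_mul (sq_nonneg α)]
  congr 2
  rw [abs_inv, ← sq_abs, sq, mul_assoc, mul_inv_cancel₀ (abs_ne_zero.2 hα), mul_one]

/-! ### Gluing in time -/

/-- Concatenation at time `c`. -/
def glue {X : Type*} (c : ℝ) (f f' : ℝ → X) : ℝ → X := fun t => if t ≤ c then f t else f' t

lemma glue_of_le {X : Type*} {c t : ℝ} (f f' : ℝ → X) (h : t ≤ c) : glue c f f' t = f t := if_pos h

lemma glue_of_lt {X : Type*} {c t : ℝ} (f f' : ℝ → X) (h : c < t) : glue c f f' t = f' t :=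
  if_neg h.not_ge

lemma integrableOn_glue {a b c : ℝ} (hac : a ≤ c) (hcb : c ≤ b) {R R' : ℝ → ℝ}
    (h : IntegrableOn R (Icc a c)) (h' : IntegrableOn R' (Icc c b)) :
    IntegrableOn (glue c R R') (Icc a b) := by
  have h1 : IntegrableOn (glue c R R') (Icc a c) :=
    h.congr_fun (fun t ht => (glue_of_le R R' ht.2).symm) measurableSet_Icc
  have h2 : IntegrableOn (glue c R R') (Ioc c b) :=
    (h'.mono_set Ioc_subset_Icc_self).congr_fun
      (fun t ht => (glue_of_lt R R' ht.1).symm) measurableSet_Ioc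
  have := h1.union h2
  rwa [Icc_union_Ioc_eq_Icc hac hcb] at this

lemma sub_eq_integral_glue {a b c : ℝ} (hac : a ≤ c) (hcb : c ≤ b) {R R' F F' : ℝ → ℝ}
    (h : IntegrableOn R (Icc a c)) (h' : IntegrableOn R' (Icc c b))
    (hF : ∀ s ∈ Icc a c, ∀ t ∈ Icc a c, F t - F s = ∫ r in s..t, R r)
    (hF' : ∀ s ∈ Icc c b, ∀ t ∈ Icc c b, F' t - F' s = ∫ r in s..t, R' r) (hc : F c = F' c) :
    ∀ s ∈ Icc a b, ∀ t ∈ Icc a b, glue c F F' t - glue c F F' s = ∫ r in s..t, glue c R R' r := by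
  have hI : ∀ s ∈ Icc a b, ∀ t ∈ Icc a b, IntervalIntegrable (glue c R R') volume s t := by
    intro s hs t ht
    exact ((integrableOn_glue hac hcb h h').mono_set
      (ordConnected_Icc.uIcc_subset hs ht)).intervalIntegrable
  -- Integrating from the junction $c$ keeps each integral within one piece; general endpoints
  -- follow by subtraction.
  have key : ∀ t ∈ Icc a b, glue c F F' t - F c = ∫ r in c..t, glue c R R' r := by
    intro t ht
    rcases le_or_gt t c with htc | htc
    · rw [glue_of_le _ _ htc, hF c ⟨hac, le_rfl⟩ t ⟨ht.1, htc⟩]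
      refine intervalIntegral.integral_congr fun r hr => ?_
      rw [uIcc_of_ge htc] at hr
      exact (glue_of_le _ _ hr.2).symm
    · rw [glue_of_lt _ _ htc, hc, hF' c ⟨le_rfl, hcb⟩ t ⟨htc.le, ht.2⟩]
      refine intervalIntegral.integral_congr_ae (ae_of_all _ fun r hr => ?_)
      rw [uIoc_of_le htc.le] at hr
      exact (glue_of_lt _ _ hr.1).symm
  intro s hs t ht
  rw [← intervalIntegral.integral_interval_sub_left (hI c ⟨hac, hcb⟩ t ht)
    (hI c ⟨hac, hcb⟩ s hs), ← key t ht, ← key s hs]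
  ring

lemma SolvesOn.concat {a b c : ℝ} (hac : a ≤ c) (hcb : c ≤ b)
    {μ μ' : ℝ → P2 d G} {φ ψ φ' ψ' : ℝ → Euc d → G → ℝ} (h : SolvesOn K θ a c μ φ ψ)
    (h' : SolvesOn K θ c b μ' φ' ψ') (hc : μ c = μ' c) :
    SolvesOn K θ a b (glue c μ μ') (glue c φ φ') (glue c ψ ψ') := by
  have hmeas : MeasurableSet {p : ℝ × Euc d | p.1 ≤ c} :=
    measurableSet_le measurable_fst measurable_const
  have hR : ∀ ζ : Euc d → G → ℝ, (fun t => ceRHS K θ (glue c μ μ' t)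
      (gradX (glue c φ φ' t)) (gradG (glue c ψ ψ' t)) ζ) =
      glue c (fun t => ceRHS K θ (μ t) (gradX (φ t)) (gradG (ψ t)) ζ)
        (fun t => ceRHS K θ (μ' t) (gradX (φ' t)) (gradG (ψ' t)) ζ) := by
    intro ζ; funext t
    rcases le_or_gt t c with ht | ht
    · simp only [glue_of_le _ _ ht]
    · simp only [glue_of_lt _ _ ht]
  have hI : ∀ ζ : Euc d → G → ℝ, (fun t => ∫ p, ζ p.1 p.2 ∂(glue c μ μ' t).1) =
      glue c (fun t => ∫ p, ζ p.1 p.2 ∂(μ t).1) (fun t => ∫ p, ζ p.1 p.2 ∂(μ' t).1) := by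
    intro ζ; funext t
    rcases le_or_gt t c with ht | ht
    · simp only [glue_of_le _ _ ht]
    · simp only [glue_of_lt _ _ ht]
  constructor
  · intro t g
    rcases le_or_gt t c with ht | ht
    · simp only [glue_of_le _ _ ht]; exact h.differentiable t g
    · simp only [glue_of_lt _ _ ht]; exact h'.differentiable t g
  · intro g
    have e : (fun p : ℝ × Euc d => gradX (glue c φ φ' p.1) p.2 g) = fun p =>
        if p.1 ≤ c then gradX (φ p.1) p.2 g else gradX (φ' p.1) p.2 g := by
      funext p
      rcases le_or_gt p.1 c with ht | ht
      · simp [glue_of_le _ _ ht, ht]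
      · simp [glue_of_lt _ _ ht, ht.not_ge]
    rw [e]
    exact Measurable.ite hmeas (h.measurable_v g) (h'.measurable_v g)
  · intro g g'
    have e : (fun p : ℝ × Euc d => gradG (glue c ψ ψ' p.1) p.2 g g') = fun p =>
        if p.1 ≤ c then gradG (ψ p.1) p.2 g g' else gradG (ψ' p.1) p.2 g g' := by
      funext p
      rcases le_or_gt p.1 c with ht | ht
      · simp [glue_of_le _ _ ht, ht]
      · simp [glue_of_lt _ _ ht, ht.not_ge]
    rw [e]
    exact Measurable.ite hmeas (h.measurable_h g g') (h'.measurable_h g g')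
  · intro ζ hζ
    filter_upwards [h.integrable_v ζ hζ, h'.integrable_v ζ hζ] with t h1 h2 ht
    rcases le_or_gt t c with htc | htc
    · simp only [glue_of_le _ _ htc]; exact h1 ⟨ht.1, htc⟩
    · simp only [glue_of_lt _ _ htc]; exact h2 ⟨htc.le, ht.2⟩
  · intro ζ hζ
    filter_upwards [h.integrable_h ζ hζ, h'.integrable_h ζ hζ] with t h1 h2 ht
    rcases le_or_gt t c with htc | htc
    · simp only [glue_of_le _ _ htc]; exact h1 ⟨ht.1, htc⟩
    · simp only [glue_of_lt _ _ htc]; exact h2 ⟨htc.le, ht.2⟩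
  · intro ζ hζ
    rw [hR]
    exact integrableOn_glue hac hcb (h.integrable_rhs ζ hζ) (h'.integrable_rhs ζ hζ)
  · intro ζ hζ s hs t ht
    have := sub_eq_integral_glue hac hcb (h.integrable_rhs ζ hζ) (h'.integrable_rhs ζ hζ)
      (h.equation ζ hζ) (h'.equation ζ hζ) (by rw [hc]) s hs t ht
    rw [← hI, ← hR] at this
    exact this

lemma energyOn_glue_le {a b c : ℝ} (hac : a ≤ c) (hcb : c ≤ b)
    (μ μ' : ℝ → P2 d G) (φ ψ φ' ψ' : ℝ → Euc d → G → ℝ) :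
    energyOn K θ a b (glue c μ μ') (glue c φ φ') (glue c ψ ψ')
      ≤ energyOn K θ a c μ φ ψ + energyOn K θ c b μ' φ' ψ' := by
  rw [energyOn, ← Icc_union_Ioc_eq_Icc hac hcb]
  refine (lintegral_union_le _ _ _).trans (add_le_add ?_ ?_)
  · refine setLIntegral_mono' measurableSet_Icc fun t ht => ?_
    simp only [glue_of_le _ _ ht.2, le_refl]
  · refine le_trans ?_ (lintegral_mono_set Ioc_subset_Icc_self)
    refine setLIntegral_mono' measurableSet_Ioc fun t ht => ?_
    simp only [glue_of_lt _ _ ht.1, le_refl]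

/-! ### Symmetry and the triangle inequality -/

lemma W2sq_comm_le (μ ν : P2 d G) : W2sq K θ ν μ ≤ W2sq K θ μ ν := by
  refine le_of_forall_gt fun c hc => ?_
  obtain ⟨γ, φ, ψ, hs, rfl, rfl, hlt⟩ := exists_solvesOn_of_W2sq_lt hc
  have hm : ∀ t ∈ Icc (0 : ℝ) 1, (-1) * t + 1 ∈ Icc (0 : ℝ) 1 := fun t ht =>
    ⟨by linarith [ht.2], by linarith [ht.1]⟩
  have h1 := (hs.affine (by norm_num) hm).W2sq_le
  have h2 := h1.trans (energyOn_affine_le (by norm_num) hm hs.differentiable)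
  simp only [mul_zero, zero_add, mul_one, neg_add_cancel, abs_neg, abs_one, ENNReal.ofReal_one,
    one_mul] at h2
  exact h2.trans_lt hlt

lemma W2sq_comm (μ ν : P2 d G) : W2sq K θ μ ν = W2sq K θ ν μ :=
  le_antisymm (W2sq_comm_le ν μ) (W2sq_comm_le μ ν)

/-- The first curve is run on $[0,l]$ at speed $l^{-1}$ and the second on $[l,1]$ at speed
$(1-l)^{-1}$. -/
lemma W2sq_triangle_split {l : ℝ} (h0 : 0 < l) (h1 : l < 1) {μ ν ρ : P2 d G} {a b : ℝ≥0∞}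
    (ha : W2sq K θ μ ν < a) (hb : W2sq K θ ν ρ < b) :
    W2sq K θ μ ρ ≤ ENNReal.ofReal l⁻¹ * a + ENNReal.ofReal (1 - l)⁻¹ * b := by
  obtain ⟨γ, φ, ψ, hs, rfl, hγ, hlt⟩ := exists_solvesOn_of_W2sq_lt ha
  obtain ⟨γ', φ', ψ', hs', hγ', rfl, hlt'⟩ := exists_solvesOn_of_W2sq_lt hb
  have hl : (0 : ℝ) < 1 - l := sub_pos.2 h1
  have hm : ∀ t ∈ Icc 0 l, l⁻¹ * t + 0 ∈ Icc (0 : ℝ) 1 := fun t ht => by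
    refine ⟨by have := ht.1; positivity, ?_⟩
    rw [add_zero, inv_mul_le_iff₀ h0, mul_one]; exact ht.2
  have hm' : ∀ t ∈ Icc l 1, (1 - l)⁻¹ * t + -(l * (1 - l)⁻¹) ∈ Icc (0 : ℝ) 1 := fun t ht => by
    have : (1 - l)⁻¹ * t + -(l * (1 - l)⁻¹) = (1 - l)⁻¹ * (t - l) := by ring
    rw [this]
    refine ⟨mul_nonneg (inv_nonneg.2 hl.le) (sub_nonneg.2 ht.1), ?_⟩
    rw [inv_mul_le_iff₀ hl]; linarith [ht.2]
  have e1 := hs.affine (inv_ne_zero h0.ne') hm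
  have e2 := hs'.affine (inv_ne_zero hl.ne') hm'
  have hmid : (1 - l)⁻¹ * l + -(l * (1 - l)⁻¹) = 0 := by ring
  have hend : (1 - l)⁻¹ * 1 + -(l * (1 - l)⁻¹) = 1 := by field_simp; ring
  have hc : γ (l⁻¹ * l + 0) = γ' ((1 - l)⁻¹ * l + -(l * (1 - l)⁻¹)) := by
    rw [hmid, inv_mul_cancel₀ h0.ne', add_zero, hγ, hγ']
  have e3 := (e1.concat h0.le h1.le e2 hc).W2sq_le
  rw [glue_of_le _ _ h0.le, glue_of_lt _ _ h1, hend, mul_zero, add_zero] at e3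
  refine e3.trans ((energyOn_glue_le h0.le h1.le _ _ _ _ _ _).trans (add_le_add ?_ ?_))
  · refine (energyOn_affine_le (inv_ne_zero h0.ne') hm hs.differentiable).trans ?_
    rw [abs_of_pos (inv_pos.2 h0)]
    gcongr
  · refine (energyOn_affine_le (inv_ne_zero hl.ne') hm' hs'.differentiable).trans ?_
    rw [abs_of_pos (inv_pos.2 hl)]
    gcongr

lemma W2_lt_top_iff {μ ν : P2 d G} : W2 K θ μ ν < ⊤ ↔ W2sq K θ μ ν < ⊤ := by
  rw [W2, ENNReal.rpow_lt_top_iff_of_pos (by norm_num)]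

lemma W2_lt_iff {μ ν : P2 d G} {a : ℝ≥0∞} : W2 K θ μ ν < a ↔ W2sq K θ μ ν < a ^ 2 := by
  rw [W2, ← ENNReal.rpow_natCast a 2, one_div]
  exact ENNReal.rpow_inv_lt_iff (by norm_num)

lemma W2_triangle (μ ν ρ : P2 d G) : W2 K θ μ ρ ≤ W2 K θ μ ν + W2 K θ ν ρ := by
  by_cases htop : W2 K θ μ ν + W2 K θ ν ρ = ⊤
  · rw [htop]; exact le_top
  obtain ⟨h1, h2⟩ := ENNReal.add_ne_top.1 htop
  refine ENNReal.le_of_forall_pos_le_add fun ε hε _ => ?_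
  obtain ⟨x, hx⟩ : ∃ x : ℝ≥0, (x : ℝ≥0∞) = W2 K θ μ ν := ⟨_, ENNReal.coe_toNNReal h1⟩
  obtain ⟨y, hy⟩ : ∃ y : ℝ≥0, (y : ℝ≥0∞) = W2 K θ ν ρ := ⟨_, ENNReal.coe_toNNReal h2⟩
  -- Enlarging both distances makes them positive, so that $l=a/(a+b)$ lies strictly between 0 and 1
  -- even when a distance vanishes.
  set a : ℝ≥0 := x + ε / 2 with ha
  set b : ℝ≥0 := y + ε / 2 with hb
  have ha0 : 0 < a := by positivity
  have hb0 : 0 < b := by positivity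
  have hxa : W2 K θ μ ν < a := by
    rw [← hx, ENNReal.coe_lt_coe, ha]; exact lt_add_of_pos_right _ (by positivity)
  have hyb : W2 K θ ν ρ < b := by
    rw [← hy, ENNReal.coe_lt_coe, hb]; exact lt_add_of_pos_right _ (by positivity)
  have hab : (0 : ℝ) < a + b := by positivity
  have ha0' : (0 : ℝ) < a := ha0
  have hb0' : (0 : ℝ) < b := hb0
  have key := W2sq_triangle_split (K := K) (θ := θ) (l := (a : ℝ) / (a + b)) (by positivity)
    (by rw [div_lt_one hab]; linarith) (W2_lt_iff.1 hxa) (W2_lt_iff.1 hyb)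
  have hsum : ENNReal.ofReal ((a : ℝ) / (a + b))⁻¹ * (a : ℝ≥0∞) ^ 2
      + ENNReal.ofReal (1 - (a : ℝ) / (a + b))⁻¹ * (b : ℝ≥0∞) ^ 2 = ((a + b : ℝ≥0) : ℝ≥0∞) ^ 2 := by
    have e1 : (1 - (a : ℝ) / (a + b))⁻¹ = (a + b) / b := by
      rw [one_sub_div hab.ne', add_sub_cancel_left, inv_div]
    rw [inv_div, e1, ← ENNReal.ofReal_coe_nnreal (p := a), ← ENNReal.ofReal_coe_nnreal (p := b),
      ← ENNReal.ofReal_coe_nnreal (p := a + b), ← ENNReal.ofReal_pow a.coe_nonneg, ← ENNReal.ofReal_pow b.coe_nonneg,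
      ← ENNReal.ofReal_pow (a + b).coe_nonneg, ← ENNReal.ofReal_mul (by positivity),
      ← ENNReal.ofReal_mul (by positivity), ← ENNReal.ofReal_add (by positivity) (by positivity)]
    congr 1
    push_cast
    field_simp
  rw [hsum] at key
  have hW : W2 K θ μ ρ ≤ ((a + b : ℝ≥0) : ℝ≥0∞) := by
    rw [W2, one_div, ENNReal.rpow_inv_le_iff (by norm_num)]
    simpa using key
  refine hW.trans (le_of_eq ?_)
  rw [← hx, ← hy, ha, hb]
  norm_cast
  rw [add_add_add_comm, add_halves]

lemma W2sq_lt_top_trans {μ ν ρ : P2 d G} (h : W2sq K θ μ ν < ⊤) (h' : W2sq K θ ν ρ < ⊤) :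
    W2sq K θ μ ρ < ⊤ :=
  W2_lt_top_iff.1 ((W2_triangle μ ν ρ).trans_lt
    (ENNReal.add_lt_top.2 ⟨W2_lt_top_iff.2 h, W2_lt_top_iff.2 h'⟩))

end Curves

/-! ### Test functions determine measures -/

/-- The functions $x\mapsto$ `Real.smoothTransition` $(nf(x))$ converge boundedly to the indicator
of $\{f>0\}$ and are smooth whenever $f$ is. -/
lemma tendsto_integral_smoothTransition {d : ℕ} {f : Euc d → ℝ} (hf : Continuous f)
    (h0 : ∀ x, 0 ≤ f x) (μ : Measure (Euc d)) [IsFiniteMeasure μ] :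
    Filter.Tendsto (fun n : ℕ => ∫ x, Real.smoothTransition (n * f x) ∂μ) Filter.atTop
      (nhds (μ.real (Function.support f))) := by
  have hms : MeasurableSet (Function.support f) := hf.isOpen_support.measurableSet
  rw [← integral_indicator_one hms]
  refine tendsto_integral_of_dominated_convergence (fun _ => (1 : ℝ)) ?_ (integrable_const _) ?_ ?_
  · intro n
    exact (Real.smoothTransition.continuous.comp (continuous_const.mul hf)).aestronglyMeasurable
  · intro n
    refine ae_of_all _ fun x => ?_
    rw [Real.norm_of_nonneg (Real.smoothTransition.nonneg _)]
    exact Real.smoothTransition.le_one _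
  · refine ae_of_all _ fun x => ?_
    by_cases hx : x ∈ Function.support f
    · have hpos : 0 < f x := lt_of_le_of_ne (h0 x) (Ne.symm hx)
      obtain ⟨N, hN⟩ := exists_nat_ge (f x)⁻¹
      refine tendsto_const_nhds.congr' ?_
      filter_upwards [Filter.eventually_ge_atTop N] with n hn
      rw [indicator_of_mem hx, Real.smoothTransition.one_of_one_le, Pi.one_apply]
      have : (f x)⁻¹ ≤ n := hN.trans (by exact_mod_cast hn)
      calc (1 : ℝ) = (f x)⁻¹ * f x := (inv_mul_cancel₀ hpos.ne').symm
        _ ≤ n * f x := by gcongr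
    · have : f x = 0 := by simpa using hx
      simp [this, Real.smoothTransition.zero]

/-- A bounded open set is the support of a smooth nonnegative function, so its indicator is a limit
of test functions. Exhaustion by balls reaches all open sets, a π-system generating the Borel sets.
-/
lemma measure_eq_of_integral_test_eq {d : ℕ} {μ ν : Measure (Euc d)} [IsFiniteMeasure μ]
    [IsFiniteMeasure ν] (h : ∀ f : Euc d → ℝ, ContDiff ℝ (⊤ : ℕ∞) f → HasCompactSupport f →
      ∫ x, f x ∂μ = ∫ x, f x ∂ν) : μ = ν := by
  have hb : ∀ U : Set (Euc d), IsOpen U → Bornology.IsBounded U → μ U = ν U := by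
    intro U hU hbd
    obtain ⟨f, hfs, hfd, hfr⟩ := hU.exists_contDiff_support_eq (n := (⊤ : ℕ∞))
    have h0 : ∀ x, 0 ≤ f x := fun x => (hfr (mem_range_self x)).1
    have h1 := tendsto_integral_smoothTransition hfd.continuous h0 μ
    have h2 := tendsto_integral_smoothTransition hfd.continuous h0 ν
    have h3 : ∀ n : ℕ, ∫ x, Real.smoothTransition (n * f x) ∂μ
        = ∫ x, Real.smoothTransition (n * f x) ∂ν := by
      intro n
      refine h _ (Real.smoothTransition.contDiff.comp (contDiff_const.mul hfd)) ?_
      refine HasCompactSupport.intro hbd.isCompact_closure fun x hx => ?_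
      have : f x = 0 := by
        by_contra hne
        exact hx (subset_closure (hfs ▸ hne))
      simp [this, Real.smoothTransition.zero]
    simp only [h3] at h1
    have := tendsto_nhds_unique h1 h2
    rw [hfs, measureReal_def, measureReal_def] at this
    exact (ENNReal.toReal_eq_toReal_iff' (measure_ne_top _ _) (measure_ne_top _ _)).1 this
  have ho : ∀ U : Set (Euc d), IsOpen U → μ U = ν U := by
    intro U hU
    have hmono : Monotone fun n : ℕ => U ∩ Metric.ball (0 : Euc d) n := fun m n hmn =>
      inter_subset_inter_right _ (Metric.ball_subset_ball (by exact_mod_cast hmn))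
    have hun : ⋃ n : ℕ, U ∩ Metric.ball (0 : Euc d) n = U := by
      rw [← inter_iUnion, Metric.iUnion_ball_nat, inter_univ]
    have h1 := tendsto_measure_iUnion_atTop (μ := μ) hmono
    have h2 := tendsto_measure_iUnion_atTop (μ := ν) hmono
    rw [hun] at h1 h2
    refine tendsto_nhds_unique h1 (h2.congr fun n => ?_)
    exact (hb _ (hU.inter Metric.isOpen_ball)
      (Metric.isBounded_ball.subset inter_subset_right)).symm
  exact ext_of_generate_finite _ BorelSpace.measurable_eq isPiSystem_isOpen
    (fun U hU => ho U hU) (ho _ isOpen_univ)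

section Mobility

variable {d : ℕ} {G : Type*} {θ : Euc d → G → G → ℝ → ℝ → ℝ}

/-! ### Bounds on the mobility -/

/-- Homogeneity at $\lambda=0$ gives $\theta(0,0)=0<\theta(1,1)$. Hence (A1)–(A5) always select the
second branch of `hat`. -/
lemma AssumptionA1A5.not_massIndependent [Nonempty G] (h : AssumptionA1A5 θ) : ¬ MassIndependent θ := by
  intro hm
  obtain ⟨c, hc, hb⟩ := h.boundedBelow {0} isCompact_singleton
  obtain ⟨g⟩ := ‹Nonempty G›
  have h1 := h.homogeneous 0 g g 0 1 1 le_rfl zero_le_one zero_le_one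
  have h2 := hm 0 g g (0 * 1) (0 * 1) 1 1 (by simp) (by simp) zero_le_one zero_le_one
  have h3 := hb 0 rfl g g
  linarith

lemma AssumptionA1A5.le_one_one (h : AssumptionA1A5 θ) {x : Euc d} {g g' : G} {s t : ℝ}
    (hs : 0 ≤ s) (hs1 : s ≤ 1) (ht : 0 ≤ t) (ht1 : t ≤ 1) : θ x g g' s t ≤ θ x g g' 1 1 :=
  calc θ x g g' s t ≤ θ x g g' 1 t := h.mono x g g' s 1 t hs hs1 ht
    _ = θ x g g' t 1 := h.symm x g g' 1 t zero_le_one ht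
    _ ≤ θ x g g' 1 1 := h.mono x g g' t 1 1 ht ht1 zero_le_one

/-- By homogeneity the left side is $\theta(r,r)$; symmetry turns monotonicity in the first argument
into monotonicity in both. -/
lemma AssumptionA1A5.mul_le (h : AssumptionA1A5 θ) {x : Euc d} {g g' : G} {r s t : ℝ}
    (hr : 0 ≤ r) (hs : r ≤ s) (ht : r ≤ t) : r * θ x g g' 1 1 ≤ θ x g g' s t := by
  have h0 := h.homogeneous x g g' r 1 1 hr zero_le_one zero_le_one
  rw [mul_one] at h0
  rw [← h0]
  calc θ x g g' r r ≤ θ x g g' s r := h.mono x g g' r s r hr hs hr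
    _ = θ x g g' r s := h.symm x g g' s r (hr.trans hs) hr
    _ ≤ θ x g g' t s := h.mono x g g' r t s hr ht (hr.trans hs)
    _ = θ x g g' s t := h.symm x g g' t s (hr.trans ht) (hr.trans hs)

/-! ### Bounds on test functions -/

lemma IsTest.continuous_gradX {ζ : Euc d → G → ℝ} (hζ : IsTest ζ) (g : G) :
    Continuous fun x => gradX ζ x g :=
  (LinearIsometryEquiv.continuous _).comp ((hζ.smooth g).continuous_fderiv (by simp))

lemma IsTest.measurable_gradG {ζ : Euc d → G → ℝ} (hζ : IsTest ζ) (g g' : G) :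
    Measurable fun x => gradG ζ x g g' :=
  ((hζ.smooth g').continuous.sub (hζ.smooth g).continuous).measurable

lemma IsTest.exists_norm_gradX_le [Fintype G] {ζ : Euc d → G → ℝ} (hζ : IsTest ζ) :
    ∃ A : ℝ, ∀ x g, ‖gradX ζ x g‖ ≤ A := by
  have h : ∀ g, ∃ A : ℝ, ∀ x, ‖gradX ζ x g‖ ≤ A := fun g => by
    obtain ⟨A, hA⟩ := ((hζ.compactSupport g).fderiv ℝ).exists_bound_of_continuous
      ((hζ.smooth g).continuous_fderiv (by simp))
    exact ⟨A, fun x => by rw [gradX, gradient, LinearIsometryEquiv.norm_map]; exact hA x⟩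
  choose A hA using h
  exact ⟨∑ g, |A g|, fun x g => ((hA g x).trans (le_abs_self _)).trans
    (Finset.single_le_sum (f := fun g => |A g|) (fun _ _ => abs_nonneg _) (Finset.mem_univ g))⟩

lemma IsTest.exists_abs_gradG_le [Fintype G] {ζ : Euc d → G → ℝ} (hζ : IsTest ζ) :
    ∃ (B : ℝ) (C : Set (Euc d)), IsCompact C ∧ (∀ x g g', |gradG ζ x g g'| ≤ B) ∧
      ∀ x ∉ C, ∀ g g', gradG ζ x g g' = 0 := by
  choose A hA using fun g =>
    (hζ.compactSupport g).exists_bound_of_continuous (hζ.smooth g).continuous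
  have hA' : ∀ x g, |ζ x g| ≤ ∑ g, |A g| := fun x g => ((hA g x).trans (le_abs_self _)).trans
    (Finset.single_le_sum (f := fun g => |A g|) (fun _ _ => abs_nonneg _) (Finset.mem_univ g))
  refine ⟨∑ g, |A g| + ∑ g, |A g|, ⋃ g, tsupport fun x => ζ x g,
    isCompact_iUnion fun g => hζ.compactSupport g, fun x g g' => ?_, fun x hx g g' => ?_⟩
  · exact (abs_sub _ _).trans (add_le_add (hA' x g') (hA' x g))
  · have h0 : ∀ g, ζ x g = 0 := fun g =>
      image_eq_zero_of_notMem_tsupport (f := fun x => ζ x g)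
        fun h => hx (mem_iUnion.2 ⟨g, h⟩)
    simp [gradG, h0]

end Mobility

/-! ### Distance zero forces equality -/

section Separation

variable {d : ℕ} {G : Type*} [Fintype G] [Nonempty G] [MeasurableSpace G]
    [DiscreteMeasurableSpace G] {K : G → G → ℝ} {θ : Euc d → G → G → ℝ → ℝ → ℝ}

/-- Test functions supported on a single vertex identify each slice over $G$, and finitely many
slices make up the measure. -/
lemma eq_of_integral_isTest_eq {μ ν : P2 d G} (h : ∀ ζ : Euc d → G → ℝ, IsTest ζ →
    ∫ p, ζ p.1 p.2 ∂μ.1 = ∫ p, ζ p.1 p.2 ∂ν.1) : μ = ν := by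
  classical
  have hms : ∀ g : G, MeasurableSet (Prod.snd ⁻¹' {g} : Set (Euc d × G)) := fun g =>
    measurable_snd (measurableSet_singleton g)
  have hslice : ∀ g : G, (μ.1.restrict (Prod.snd ⁻¹' {g})).map Prod.fst
      = (ν.1.restrict (Prod.snd ⁻¹' {g})).map Prod.fst := by
    intro g
    refine measure_eq_of_integral_test_eq fun f hf hfc => ?_
    have key : ∀ ρ : P2 d G, ∫ x, f x ∂((ρ.1.restrict (Prod.snd ⁻¹' {g})).map Prod.fst)
        = ∫ p, (if p.2 = g then f p.1 else 0) ∂ρ.1 := by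
      intro ρ
      rw [integral_map measurable_fst.aemeasurable hf.continuous.aestronglyMeasurable,
        ← integral_indicator (hms g)]
      refine integral_congr_ae (ae_of_all _ fun p => ?_)
      simp [indicator_apply]
    rw [key, key]
    refine h (fun x g' => if g' = g then f x else 0) ⟨fun g' => ?_, fun g' => ?_⟩
    · by_cases hg : g' = g
      · simpa [hg] using hf
      · simpa [hg] using contDiff_const
    · by_cases hg : g' = g
      · simpa [hg] using hfc
      · simp only [hg, if_false]; exact HasCompactSupport.zero
  refine Subtype.ext (Measure.ext fun S hS => ?_)
  have key : ∀ ρ : P2 d G, ρ.1 S = ∑ g, ((ρ.1.restrict (Prod.snd ⁻¹' {g})).map Prod.fst)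
      ((fun x => (x, g)) ⁻¹' S) := by
    intro ρ
    have h1 := sum_measure_preimage_singleton (μ := ρ.1.restrict S) (f := Prod.snd)
      (Finset.univ : Finset G) (fun g _ => hms g)
    simp only [Finset.coe_univ, preimage_univ, Measure.restrict_apply_univ] at h1
    rw [← h1]
    refine Finset.sum_congr rfl fun g _ => ?_
    rw [Measure.map_apply measurable_fst (hS.preimage measurable_prodMk_right),
      Measure.restrict_apply (hms g), Measure.restrict_apply
      ((hS.preimage measurable_prodMk_right).preimage measurable_fst)]
    congr 1
    ext ⟨x, g'⟩
    simp only [mem_inter_iff, mem_preimage, mem_singleton_iff]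
    constructor
    · rintro ⟨rfl, hx⟩; exact ⟨hx, rfl⟩
    · rintro ⟨hx, rfl⟩; exact ⟨rfl, hx⟩
  rw [key, key]
  simp only [hslice]

/-! ### The measure `μ̂` is bounded on compact sets -/

/-- The bound is uniform in $\mu$: under (A0) $\hat\mu$ does not involve $\mu$, and otherwise its
density is at most $\theta_{x,g,g'}(1,1)$ against a marginal of mass one. -/
lemma exists_hat_le (hA : AssumptionA0 θ ∨ AssumptionA1A5 θ) {C : Set (Euc d)} (hC : IsCompact C) :
    ∃ M : ℝ≥0, ∀ (μ : P2 d G) (g g' : G), hat θ μ g g' C ≤ M := by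
  rcases hA with hA | hA
  · have hfin : ∀ g g', ∫⁻ x in C, ENNReal.ofReal (θ x g g' 1 1) ≠ ⊤ := fun g g' =>
      (((hA.locallyIntegrable g g').integrableOn_isCompact hC).lintegral_lt_top).ne
    refine ⟨∑ g, ∑ g', (∫⁻ x in C, ENNReal.ofReal (θ x g g' 1 1)).toNNReal, fun μ g g' => ?_⟩
    rw [hat, if_pos hA.massIndependent, withDensity_apply _ hC.measurableSet,
      ← ENNReal.coe_toNNReal (hfin g g'), ENNReal.coe_le_coe]
    refine le_trans ?_ (Finset.single_le_sum (fun _ _ => zero_le) (Finset.mem_univ g))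
    exact Finset.single_le_sum (f := fun g' =>
      (∫⁻ x in C, ENNReal.ofReal (θ x g g' 1 1)).toNNReal) (fun _ _ => zero_le) (Finset.mem_univ g')
  · obtain ⟨M, hM⟩ := hA.locallyBounded C hC
    refine ⟨M.toNNReal, fun μ g g' => ?_⟩
    rw [hat, if_neg hA.not_massIndependent, withDensity_apply _ hC.measurableSet]
    calc _ ≤ ∫⁻ _ in C, (M.toNNReal : ℝ≥0∞) ∂μ.1.fst := by
          refine setLIntegral_mono' hC.measurableSet fun x hx => ?_
          refine ENNReal.ofReal_le_ofReal (le_trans ?_ (hM x hx g g'))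
          exact hA.le_one_one measureReal_nonneg measureReal_le_one measureReal_nonneg
            measureReal_le_one
      _ ≤ M.toNNReal := by
          rw [setLIntegral_const]
          exact mul_le_of_le_one_right' prob_le_one

/-! ### The energy controls the speed -/

/-- Young's inequality up to constants: comparing $y$ with $\varepsilon x$ shows that one summand
alone suffices. -/
lemma mul_le_eps_sq_add {ε : ℝ≥0∞} (h0 : ε ≠ 0) (ht : ε ≠ ⊤) (x y : ℝ≥0∞) :
    x * y ≤ ε * x ^ 2 + ε⁻¹ * y ^ 2 := by
  rcases le_total y (ε * x) with h | h
  · refine le_trans ?_ le_self_add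
    calc x * y ≤ x * (ε * x) := by gcongr
      _ = ε * x ^ 2 := by ring
  · refine le_trans ?_ le_add_self
    have : x ≤ ε⁻¹ * y := by
      rw [mul_comm, ← div_eq_mul_inv, ENNReal.le_div_iff_mul_le (Or.inl h0) (Or.inl ht), mul_comm]
      exact h
    calc x * y ≤ (ε⁻¹ * y) * y := by gcongr
      _ = ε⁻¹ * y ^ 2 := by ring

/-- Young's inequality is applied under each integral. The part coming from $\zeta$ is a constant or
a multiple of an indicator, so the integrals split without measurability of $v$ or $h$. -/
lemma enorm_ceRHS_le (hK : ∀ g g', 0 ≤ K g g') {ζ : Euc d → G → ℝ} {A B : ℝ} {C : Set (Euc d)}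
    (hC : MeasurableSet C) (hA : ∀ x g, ‖gradX ζ x g‖ ≤ A) (hB : ∀ x g g', |gradG ζ x g g'| ≤ B)
    (hBC : ∀ x ∉ C, ∀ g g', gradG ζ x g g' = 0)
    {ε : ℝ≥0∞} (h0 : ε ≠ 0) (ht : ε ≠ ⊤)
    (μ : P2 d G) (v : Euc d → G → Euc d) (h : Euc d → G → G → ℝ) :
    ‖ceRHS K θ μ v h ζ‖ₑ ≤ ε * (ENNReal.ofReal A ^ 2
        + ∑ g, ∑ g', ENNReal.ofReal B ^ 2 * ENNReal.ofReal (K g g') * hat θ μ g g' C)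
      + ε⁻¹ * energyDensity K θ μ v h := by
  have hεi : ε⁻¹ ≠ ⊤ := ENNReal.inv_ne_top.2 h0
  have e1 : ‖∫ p, inner ℝ (gradX ζ p.1 p.2) (v p.1 p.2) ∂μ.1‖ₑ
      ≤ ε * ENNReal.ofReal A ^ 2 + ε⁻¹ * ∫⁻ p, ‖v p.1 p.2‖ₑ ^ 2 ∂μ.1 := by
    refine (enorm_integral_le_lintegral_enorm _).trans ?_
    calc _ ≤ ∫⁻ p, (ε * ENNReal.ofReal A ^ 2 + ε⁻¹ * ‖v p.1 p.2‖ₑ ^ 2) ∂μ.1 := by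
          refine lintegral_mono fun p => ?_
          calc ‖inner ℝ (gradX ζ p.1 p.2) (v p.1 p.2)‖ₑ
              ≤ ‖gradX ζ p.1 p.2‖ₑ * ‖v p.1 p.2‖ₑ := by
                rw [← ofReal_norm, ← ofReal_norm, ← ofReal_norm,
                  ← ENNReal.ofReal_mul (norm_nonneg _)]
                exact ENNReal.ofReal_le_ofReal (norm_inner_le_norm _ _)
            _ ≤ ENNReal.ofReal A * ‖v p.1 p.2‖ₑ := by
                gcongr
                rw [← ofReal_norm]
                exact ENNReal.ofReal_le_ofReal (hA _ _)
            _ ≤ _ := mul_le_eps_sq_add h0 ht _ _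
      _ = _ := by
          rw [lintegral_add_left measurable_const, lintegral_const_mul' _ _ hεi, lintegral_const,
            measure_univ, mul_one]
  have e2 : ∀ g g', ‖∫ x, gradG ζ x g g' * h x g g' * K g g' ∂(hat θ μ g g')‖ₑ
      ≤ ε * (ENNReal.ofReal B ^ 2 * ENNReal.ofReal (K g g') * hat θ μ g g' C)
        + ε⁻¹ * ∫⁻ x, ENNReal.ofReal (h x g g' ^ 2 * K g g') ∂(hat θ μ g g') := by
    intro g g'
    refine (enorm_integral_le_lintegral_enorm _).trans ?_
    calc _ ≤ ∫⁻ x, (C.indicator (fun _ => ε * (ENNReal.ofReal B ^ 2 * ENNReal.ofReal (K g g'))) x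
              + ε⁻¹ * ENNReal.ofReal (h x g g' ^ 2 * K g g')) ∂(hat θ μ g g') := by
          refine lintegral_mono fun x => ?_
          by_cases hx : x ∈ C
          · rw [indicator_of_mem hx]
            have hh : ENNReal.ofReal (h x g g' ^ 2 * K g g')
                = ‖h x g g'‖ₑ ^ 2 * ENNReal.ofReal (K g g') := by
              rw [ENNReal.ofReal_mul (sq_nonneg _), ← sq_abs, ENNReal.ofReal_pow (abs_nonneg _),
                Real.enorm_eq_ofReal_abs]
            rw [hh, enorm_mul, enorm_mul, Real.enorm_of_nonneg (hK g g')]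
            calc _ ≤ (ENNReal.ofReal B * ‖h x g g'‖ₑ) * ENNReal.ofReal (K g g') := by
                  gcongr
                  rw [Real.enorm_eq_ofReal_abs]
                  exact ENNReal.ofReal_le_ofReal (hB _ _ _)
              _ ≤ (ε * ENNReal.ofReal B ^ 2 + ε⁻¹ * ‖h x g g'‖ₑ ^ 2) * ENNReal.ofReal (K g g') := by
                  gcongr
                  exact mul_le_eps_sq_add h0 ht _ _
              _ = _ := by ring
          · simp [hBC x hx]
      _ = _ := by
          rw [lintegral_add_left (measurable_const.indicator hC), lintegral_const_mul' _ _ hεi,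
            lintegral_indicator_const hC, mul_assoc ε]
  calc ‖ceRHS K θ μ v h ζ‖ₑ ≤ (ε * ENNReal.ofReal A ^ 2 + ε⁻¹ * ∫⁻ p, ‖v p.1 p.2‖ₑ ^ 2 ∂μ.1)
        + ∑ g, ∑ g', (ε * (ENNReal.ofReal B ^ 2 * ENNReal.ofReal (K g g') * hat θ μ g g' C)
        + ε⁻¹ * ∫⁻ x, ENNReal.ofReal (h x g g' ^ 2 * K g g') ∂(hat θ μ g g')) := by
        refine (enorm_add_le _ _).trans (add_le_add e1 ?_)
        refine (enorm_sum_le _ _).trans (Finset.sum_le_sum fun g _ => ?_)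
        exact (enorm_sum_le _ _).trans (Finset.sum_le_sum fun g' _ => e2 g g')
    _ = _ := by
        simp only [energyDensity, Finset.sum_add_distrib, mul_add, Finset.mul_sum]
        ring

lemma eq_of_W2sq_eq_zero (hK : ∀ g g', 0 ≤ K g g') (hA : AssumptionA0 θ ∨ AssumptionA1A5 θ)
    {μ ν : P2 d G} (h : W2sq K θ μ ν = 0) : μ = ν := by
  refine eq_of_integral_isTest_eq fun ζ hζ => ?_
  obtain ⟨A, hA'⟩ := hζ.exists_norm_gradX_le
  obtain ⟨B, C, hC, hB, hBC⟩ := hζ.exists_abs_gradG_le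
  obtain ⟨M, hM⟩ := exists_hat_le (θ := θ) hA hC
  set D : ℝ≥0∞ := ENNReal.ofReal A ^ 2
    + ∑ g : G, ∑ g', ENNReal.ofReal B ^ 2 * ENNReal.ofReal (K g g') * M with hD
  have hDt : D ≠ ⊤ := by
    refine ENNReal.add_ne_top.2 ⟨ENNReal.pow_ne_top ENNReal.ofReal_ne_top, ?_⟩
    refine ENNReal.sum_ne_top.2 fun g _ => ENNReal.sum_ne_top.2 fun g' _ => ?_
    exact ENNReal.mul_ne_top (ENNReal.mul_ne_top (ENNReal.pow_ne_top ENNReal.ofReal_ne_top)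
      ENNReal.ofReal_ne_top) ENNReal.coe_ne_top
  have key : ∀ ε : ℝ≥0, 0 < ε →
      ‖∫ p, ζ p.1 p.2 ∂ν.1 - ∫ p, ζ p.1 p.2 ∂μ.1‖ₑ ≤ ε * (D + 1) := by
    intro ε hε
    have h0 : (ε : ℝ≥0∞) ≠ 0 := by exact_mod_cast hε.ne'
    -- An energy below $\varepsilon^2$ matches the weight $\varepsilon^{-1}$ in front of it, leaving
    -- a total of order $\varepsilon$.
    have hlt : W2sq K θ μ ν < (ε : ℝ≥0∞) ^ 2 := by rw [h]; positivity
    obtain ⟨γ, φ, ψ, hs, rfl, rfl, hE⟩ := exists_solvesOn_of_W2sq_lt hlt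
    rw [hs.equation ζ hζ 0 (by simp) 1 (by simp), intervalIntegral.integral_of_le zero_le_one]
    refine (enorm_integral_le_lintegral_enorm _).trans ?_
    refine (lintegral_mono_set Ioc_subset_Icc_self).trans ?_
    calc ∫⁻ t in Icc (0 : ℝ) 1, ‖ceRHS K θ (γ t) (gradX (φ t)) (gradG (ψ t)) ζ‖ₑ
        ≤ ∫⁻ t in Icc (0 : ℝ) 1, (ε * D + (ε : ℝ≥0∞)⁻¹
            * energyDensity K θ (γ t) (gradX (φ t)) (gradG (ψ t))) := by
          refine lintegral_mono fun t => ?_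
          refine (enorm_ceRHS_le hK hC.measurableSet hA' hB hBC h0 ENNReal.coe_ne_top _ _ _).trans ?_
          rw [hD]
          gcongr
          exact hM _ _ _
      _ = ε * D + (ε : ℝ≥0∞)⁻¹ * energyOn K θ 0 1 γ φ ψ := by
          rw [lintegral_add_left measurable_const,
            lintegral_const_mul' _ _ (ENNReal.inv_ne_top.2 h0), setLIntegral_const,
            Real.volume_Icc, sub_zero, ENNReal.ofReal_one, mul_one, energyOn]
      _ ≤ ε * D + (ε : ℝ≥0∞)⁻¹ * (ε : ℝ≥0∞) ^ 2 := by gcongr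
      _ = ε * (D + 1) := by
          rw [sq, ← mul_assoc, ENNReal.inv_mul_cancel h0 ENNReal.coe_ne_top]; ring
  have hzero : ‖∫ p, ζ p.1 p.2 ∂ν.1 - ∫ p, ζ p.1 p.2 ∂μ.1‖ₑ = 0 := by
    refine le_antisymm (ENNReal.le_of_forall_pos_le_add fun δ hδ _ => ?_) zero_le
    clear_value D
    lift D to ℝ≥0 using hDt
    refine (key (δ / (D + 1)) (by positivity)).trans (le_of_eq ?_)
    rw [zero_add]
    norm_cast
    field_simp
  exact (sub_eq_zero.1 (enorm_eq_zero.1 hzero)).symm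

lemma W2sq_self (μ : P2 d G) : W2sq K θ μ μ = 0 := by
  have hx : gradX (fun (_ : Euc d) (_ : G) => (0 : ℝ)) = fun _ _ => 0 := by
    funext x g; simp [gradX, gradient]
  have hg : gradG (fun (_ : Euc d) (_ : G) => (0 : ℝ)) = fun _ _ _ => 0 := by
    funext x g g'; simp [gradG]
  have hs : SolvesOn K θ 0 1 (fun _ => μ) (fun _ _ _ => 0) (fun _ _ _ => 0) := by
    constructor <;> simp [hx, hg, ceRHS]
  have h1 := hs.W2sq_le
  refine le_antisymm (h1.trans (le_of_eq ?_)) zero_le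
  simp [energyOn, energyDensity, hx, hg]

lemma W2_eq_zero_iff (hK : ∀ g g', 0 ≤ K g g') (hA : AssumptionA0 θ ∨ AssumptionA1A5 θ)
    (μ ν : P2 d G) : W2 K θ μ ν = 0 ↔ μ = ν := by
  have h : W2 K θ μ ν = 0 ↔ W2sq K θ μ ν = 0 := by
    rw [W2, ENNReal.rpow_eq_zero_iff_of_pos (by norm_num)]
  rw [h]
  exact ⟨eq_of_W2sq_eq_zero hK hA, fun e => by rw [e, W2sq_self]⟩

end Separation

/-! ### Dilations -/

section Smooth

variable {d : ℕ} {G : Type*}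

lemma gradX_norm_sq (c : ℝ) :
    gradX (fun (x : Euc d) (_ : G) => c * ‖x‖ ^ 2) = fun x _ => (2 * c) • x := by
  funext x g
  have h : HasFDerivAt (fun y : Euc d => c * ‖y‖ ^ 2) (c • (2 • innerSL ℝ x)) x :=
    ((hasStrictFDerivAt_norm_sq x).hasFDerivAt).const_mul c
  rw [gradX, gradient, h.fderiv]
  refine ext_inner_right ℝ fun y => ?_
  rw [InnerProductSpace.toDual_symm_apply, inner_smul_left]
  simp
  ring

lemma IsTest.hasDerivAt_dilation {ζ : Euc d → G → ℝ} (hζ : IsTest ζ) (x : Euc d) (g : G) (r : ℝ) :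
    HasDerivAt (fun r : ℝ => ζ (r • x) g) (inner ℝ (gradX ζ (r • x) g) x) r := by
  have h1 : HasDerivAt (fun r : ℝ => r • x) x r := by
    simpa using (hasDerivAt_id r).smul_const x
  have h2 : HasFDerivAt (fun y => ζ y g) (fderiv ℝ (fun y => ζ y g) (r • x)) (r • x) :=
    ((hζ.smooth g).differentiable (by simp) _).hasFDerivAt
  have := h2.comp_hasDerivAt r h1
  rwa [gradX, gradient, InnerProductSpace.toDual_symm_apply]

lemma IsTest.exists_abs_le [Fintype G] {ζ : Euc d → G → ℝ} (hζ : IsTest ζ) :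
    ∃ A : ℝ, ∀ x g, ‖ζ x g‖ ≤ A := by
  choose A hA using fun g =>
    (hζ.compactSupport g).exists_bound_of_continuous (hζ.smooth g).continuous
  exact ⟨∑ g, |A g|, fun x g => ((hA g x).trans (le_abs_self _)).trans
    (Finset.single_le_sum (f := fun g => |A g|) (fun _ _ => abs_nonneg _) (Finset.mem_univ g))⟩

end Smooth

section Dilation

variable {d : ℕ} {G : Type*} [MeasurableSpace G]

lemma measurable_dilation (t : ℝ) : Measurable fun p : Euc d × G => (t • p.1, p.2) :=
  (measurable_fst.const_smul t).prodMk measurable_snd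

/-- The image of `μ` under the dilation `(x,g) ↦ (t x, g)`. -/
def dilate (μ : P2 d G) (t : ℝ) : P2 d G :=
  ⟨μ.1.map fun p => (t • p.1, p.2), by
    refine ⟨Measure.isProbabilityMeasure_map (measurable_dilation t).aemeasurable, ?_⟩
    rw [lintegral_map ((measurable_fst.enorm).pow_const 2) (measurable_dilation t)]
    simp only [enorm_smul, mul_pow]
    rw [lintegral_const_mul' _ _ (ENNReal.pow_ne_top enorm_ne_top)]
    exact ENNReal.mul_lt_top (ENNReal.pow_lt_top enorm_lt_top) μ.2.2⟩

lemma integral_dilate {f : Euc d × G → ℝ} (hf : Measurable f) (μ : P2 d G) (t : ℝ) :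
    ∫ p, f p ∂(dilate μ t).1 = ∫ p, f (t • p.1, p.2) ∂μ.1 :=
  integral_map (measurable_dilation t).aemeasurable hf.aestronglyMeasurable

lemma lintegral_dilate {f : Euc d × G → ℝ≥0∞} (hf : Measurable f) (μ : P2 d G) (t : ℝ) :
    ∫⁻ p, f p ∂(dilate μ t).1 = ∫⁻ p, f (t • p.1, p.2) ∂μ.1 :=
  lintegral_map hf (measurable_dilation t)

lemma dilate_one (μ : P2 d G) : dilate μ 1 = μ :=
  Subtype.ext (by simp [dilate])

/-- Dilation by 0 puts all mass over the origin and forgets everything but the distribution on $G$.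
-/
lemma dilate_zero_eq {μ ν : P2 d G} (h : μ.1.snd = ν.1.snd) : dilate μ 0 = dilate ν 0 := by
  have key : ∀ ρ : P2 d G, (dilate ρ 0).1 = ρ.1.snd.map fun g => ((0 : Euc d), g) := fun ρ => by
    rw [Measure.snd, Measure.map_map measurable_prodMk_left measurable_snd]
    simp [dilate, Function.comp_def]
  exact Subtype.ext (by rw [key, key, h])

lemma integrable_norm_fst (μ : P2 d G) : Integrable (fun p : Euc d × G => ‖p.1‖) μ.1 := by
  have h : MemLp (fun p : Euc d × G => p.1) 2 μ.1 := by
    refine ⟨measurable_fst.aestronglyMeasurable, ?_⟩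
    rw [eLpNorm_lt_top_iff_lintegral_rpow_enorm_lt_top (by norm_num) (by norm_num)]
    simpa using μ.2.2
  exact (h.integrable (by norm_num)).norm

variable [Fintype G] [DiscreteMeasurableSpace G]

lemma IsTest.measurable_gradX {ζ : Euc d → G → ℝ} (hζ : IsTest ζ) :
    Measurable fun p : Euc d × G => gradX ζ p.1 p.2 :=
  measurable_from_prod_countable_left fun g => (hζ.continuous_gradX g).measurable

lemma IsTest.measurable {ζ : Euc d → G → ℝ} (hζ : IsTest ζ) :
    Measurable fun p : Euc d × G => ζ p.1 p.2 :=
  measurable_from_prod_countable_left fun g => (hζ.smooth g).continuous.measurable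

lemma IsTest.integrable {ζ : Euc d → G → ℝ} (hζ : IsTest ζ) (μ : Measure (Euc d × G))
    [IsFiniteMeasure μ] : Integrable (fun p : Euc d × G => ζ p.1 p.2) μ := by
  obtain ⟨A, hA⟩ := hζ.exists_abs_le
  exact Integrable.of_bound hζ.measurable.aestronglyMeasurable A (ae_of_all _ fun p => hA _ _)

lemma IsTest.integrable_inner_gradX_dilation {ζ : Euc d → G → ℝ} (hζ : IsTest ζ) (μ : P2 d G)
    (m : Measure ℝ) [IsFiniteMeasure m] : Integrable
      (fun q : ℝ × Euc d × G => inner ℝ (gradX ζ (q.1 • q.2.1) q.2.2) q.2.1) (m.prod μ.1) := by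
  obtain ⟨A, hA⟩ := hζ.exists_norm_gradX_le
  have hmeas : Measurable fun q : ℝ × Euc d × G => inner ℝ (gradX ζ (q.1 • q.2.1) q.2.2) q.2.1 :=
    (hζ.measurable_gradX.comp ((measurable_fst.smul measurable_snd.fst).prodMk
      measurable_snd.snd)).inner measurable_snd.fst
  refine (((integrable_norm_fst μ).const_mul A).comp_snd m).mono'
    hmeas.aestronglyMeasurable (ae_of_all _ fun q => ?_)
  exact (norm_inner_le_norm _ _).trans (mul_le_mul_of_nonneg_right (hA _ _) (norm_nonneg _))

lemma IsTest.integral_dilate_sub {ζ : Euc d → G → ℝ} (hζ : IsTest ζ) (μ : P2 d G) (s t : ℝ) :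
    ∫ p, ζ p.1 p.2 ∂(dilate μ t).1 - ∫ p, ζ p.1 p.2 ∂(dilate μ s).1
      = ∫ r in s..t, ∫ p, inner ℝ (gradX ζ (r • p.1) p.2) p.1 ∂μ.1 := by
  have : IsFiniteMeasure (volume.restrict (uIoc s t)) := by rw [uIoc]; infer_instance
  have hint := hζ.integrable_inner_gradX_dilation μ (volume.restrict (uIoc s t))
  have hI : ∀ r, ∫ p, ζ p.1 p.2 ∂(dilate μ r).1 = ∫ p, ζ (r • p.1) p.2 ∂μ.1 := fun r =>
    integral_dilate hζ.measurable μ r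
  have hi : ∀ r, Integrable (fun p : Euc d × G => ζ (r • p.1) p.2) μ.1 := fun r => by
    obtain ⟨B, hB⟩ := hζ.exists_abs_le
    exact Integrable.of_bound (hζ.measurable.comp (measurable_dilation r)).aestronglyMeasurable B
      (ae_of_all _ fun p => hB _ _)
  rw [hI, hI, ← integral_sub (hi t) (hi s), intervalIntegral_integral_swap hint]
  refine integral_congr_ae (ae_of_all _ fun p => ?_)
  refine (intervalIntegral.integral_eq_sub_of_hasDerivAt
    (fun r _ => hζ.hasDerivAt_dilation p.1 p.2 r) ?_).symm
  refine Continuous.intervalIntegrable ?_ _ _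
  exact ((hζ.continuous_gradX p.2).comp (continuous_id.smul continuous_const)).inner
    continuous_const

variable [Nonempty G] {K : G → G → ℝ} {θ : Euc d → G → G → ℝ → ℝ → ℝ}

/-- A particle at $tx$ moves with velocity $x=t^{-1}(tx)$, the gradient of $|y|^2/(2t)$ at $y=tx$.
Its speed is constant, so the energy is at most the second moment. -/
lemma W2sq_dilate_zero_lt_top (μ : P2 d G) : W2sq K θ (dilate μ 0) μ < ⊤ := by
  -- At $t=0$ the convention $0^{-1}=0$ makes the potential vanish; the equation may fail at that
  -- single time.
  set φ : ℝ → Euc d → G → ℝ := fun t x _ => (2 * t)⁻¹ * ‖x‖ ^ 2 with hφ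
  have hv : ∀ t, gradX (φ t) = fun x _ => t⁻¹ • x := fun t => by
    rw [hφ, gradX_norm_sq]
    funext x g
    rw [mul_inv, mul_inv_cancel_left₀ two_ne_zero]
  have hsm : ∀ c : ℝ, Measurable fun p : Euc d × G => c • p.1 := fun c =>
    measurable_fst.const_smul c
  have hg : gradG (fun (_ : Euc d) (_ : G) => (0 : ℝ)) = fun _ _ _ => 0 := by
    funext x g g'; simp [gradG]
  have hrhs : ∀ ζ : Euc d → G → ℝ, IsTest ζ → ∀ t ≠ 0,
      ceRHS K θ (dilate μ t) (gradX (φ t)) (gradG fun _ _ => 0) ζ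
        = ∫ p, inner ℝ (gradX ζ (t • p.1) p.2) p.1 ∂μ.1 := by
    intro ζ hζ t ht
    simp only [ceRHS, hv, hg, mul_zero, zero_mul, integral_zero, Finset.sum_const_zero, add_zero]
    rw [integral_dilate (f := fun p => inner ℝ (gradX ζ p.1 p.2) (t⁻¹ • p.1))
      (hζ.measurable_gradX.inner (hsm _))]
    simp only [inv_smul_smul₀ ht]
  have hrhs' : ∀ ζ : Euc d → G → ℝ, IsTest ζ → ∀ᵐ t : ℝ,
      ceRHS K θ (dilate μ t) (gradX (φ t)) (gradG fun _ _ => 0) ζ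
        = ∫ p, inner ℝ (gradX ζ (t • p.1) p.2) p.1 ∂μ.1 := by
    intro ζ hζ
    filter_upwards [Measure.ae_ne volume (0 : ℝ)] with t ht using hrhs ζ hζ t ht
  have hs : SolvesOn K θ 0 1 (dilate μ) φ (fun _ _ _ => 0) := by
    constructor
    · intro t g
      exact (differentiable_id.norm_sq ℝ).const_mul _
    · intro g
      simp only [hv]
      exact measurable_fst.inv.smul measurable_snd
    · intro g g'
      simp only [hg]
      exact measurable_const
    · intro ζ hζ
      refine ae_of_all _ fun t _ => ?_
      obtain ⟨A, hA⟩ := hζ.exists_norm_gradX_le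
      simp only [hv]
      refine ((integrable_norm_fst (dilate μ t)).const_mul (A * |t⁻¹|)).mono'
        (hζ.measurable_gradX.inner (hsm _)).aestronglyMeasurable
        (ae_of_all _ fun p => ?_)
      refine (norm_inner_le_norm _ _).trans ?_
      rw [norm_smul, Real.norm_eq_abs, mul_assoc]
      exact mul_le_mul_of_nonneg_right (hA _ _) (by positivity)
    · intro ζ hζ
      simp [hg]
    · intro ζ hζ
      have hint := hζ.integrable_inner_gradX_dilation μ (volume.restrict (Icc (0 : ℝ) 1))
      exact hint.integral_prod_left.congr (ae_restrict_of_ae ((hrhs' ζ hζ).mono fun t h => h.symm))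
    · intro ζ hζ s _ t _
      rw [hζ.integral_dilate_sub]
      exact intervalIntegral.integral_congr_ae ((hrhs' ζ hζ).mono fun t h _ => h.symm)
  have h1 := hs.W2sq_le
  rw [dilate_one] at h1
  refine h1.trans_lt ?_
  have hE : ∀ t, energyDensity K θ (dilate μ t) (gradX (φ t)) (gradG fun _ _ => 0)
      ≤ ∫⁻ p, ‖p.1‖ₑ ^ 2 ∂μ.1 := by
    intro t
    simp only [energyDensity, hv, hg]
    simp only [ne_eq, OfNat.ofNat_ne_zero, not_false_eq_true, zero_pow, zero_mul,
      ENNReal.ofReal_zero, lintegral_zero, Finset.sum_const_zero, add_zero]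
    rw [lintegral_dilate (f := fun p => ‖t⁻¹ • p.1‖ₑ ^ 2)
      (((hsm _).enorm).pow_const 2)]
    refine lintegral_mono fun p => ?_
    rcases eq_or_ne t 0 with rfl | ht
    · simp
    · rw [inv_smul_smul₀ ht]
  refine (setLIntegral_mono' measurableSet_Icc fun t _ => hE t).trans_lt ?_
  rw [setLIntegral_const, Real.volume_Icc, sub_zero, ENNReal.ofReal_one, mul_one]
  exact μ.2.2

lemma W2sq_lt_top_of_snd_eq {μ ν : P2 d G} (h : μ.1.snd = ν.1.snd) : W2sq K θ μ ν < ⊤ := by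
  refine W2sq_lt_top_trans (ν := dilate μ 0) ?_ ?_
  · rw [W2sq_comm]; exact W2sq_dilate_zero_lt_top μ
  · rw [dilate_zero_eq h]; exact W2sq_dilate_zero_lt_top ν

end Dilation

/-! ### The Laplace equation on a weighted graph -/

section Laplacian

variable {G : Type*} [Fintype G]

/-- The Dirichlet form of the edge weights `W`. -/
def dirichletForm (W : G → G → ℝ) (a b : G → ℝ) : ℝ :=
  ∑ g, ∑ g', (a g' - a g) * (b g' - b g) * W g g'

lemma sq_mul_le_dirichletForm {W : G → G → ℝ} (hW : ∀ g g', 0 ≤ W g g') (a : G → ℝ) (g g' : G) :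
    (a g' - a g) ^ 2 * W g g' ≤ dirichletForm W a a := by
  have h0 : ∀ g g', 0 ≤ (a g' - a g) * (a g' - a g) * W g g' := fun g g' =>
    mul_nonneg (mul_self_nonneg _) (hW g g')
  rw [sq]
  refine le_trans ?_ (Finset.single_le_sum (fun g _ => Finset.sum_nonneg fun g' _ => h0 g g')
    (Finset.mem_univ g))
  exact Finset.single_le_sum (f := fun g' => (a g' - a g) * (a g' - a g) * W g g')
    (fun g' _ => h0 g g') (Finset.mem_univ g')

lemma dirichletForm_nonneg {W : G → G → ℝ} (hW : ∀ g g', 0 ≤ W g g') (a : G → ℝ) :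
    0 ≤ dirichletForm W a a :=
  Finset.sum_nonneg fun g _ => Finset.sum_nonneg fun g' _ =>
    mul_nonneg (mul_self_nonneg _) (hW g g')

lemma mul_dirichletForm_le {K W : G → G → ℝ} {c : ℝ} (h : ∀ g g', c * K g g' ≤ W g g')
    (a : G → ℝ) : c * dirichletForm K a a ≤ dirichletForm W a a := by
  simp only [dirichletForm, Finset.mul_sum]
  refine Finset.sum_le_sum fun g _ => Finset.sum_le_sum fun g' _ => ?_
  calc c * ((a g' - a g) * (a g' - a g) * K g g')
      = (a g' - a g) * (a g' - a g) * (c * K g g') := by ring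
    _ ≤ _ := mul_le_mul_of_nonneg_left (h g g') (mul_self_nonneg _)

/-- A Poincaré inequality on a connected weighted graph. -/
lemma IsConnectedWeightedGraph.exists_sq_sub_le {K : G → G → ℝ}
    (hK : IsConnectedWeightedGraph K) :
    ∃ P : ℝ, 0 ≤ P ∧ ∀ (a : G → ℝ) (g g' : G), (a g' - a g) ^ 2 ≤ P * dirichletForm K a a := by
  have h : ∀ g g', ∃ P : ℝ, 0 ≤ P ∧ ∀ a : G → ℝ, (a g' - a g) ^ 2 ≤ P * dirichletForm K a a := by
    intro g g'
    induction hK.connected g g' with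
    | refl => exact ⟨0, le_rfl, fun a => by simp⟩
    | @tail b e _ hbe ih =>
      obtain ⟨P, hP, h⟩ := ih
      -- From $(x+y)^2\le 2x^2+2y^2$, with the new edge contributing at most $K(b,e)^{-1}$ times the
      -- Dirichlet form.
      refine ⟨2 * P + 2 * (K b e)⁻¹, by positivity, fun a => ?_⟩
      have h1 := h a
      have h2 : (a e - a b) ^ 2 ≤ (K b e)⁻¹ * dirichletForm K a a := by
        rw [← div_eq_inv_mul, le_div_iff₀ hbe]
        exact sq_mul_le_dirichletForm hK.nonneg a b e
      nlinarith [sq_nonneg ((a e - a b) - (a b - a g))]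
  choose P hP h using h
  refine ⟨∑ g, ∑ g', P g g', Finset.sum_nonneg fun g _ => Finset.sum_nonneg fun g' _ => hP g g',
    fun a g g' => (h g g' a).trans ?_⟩
  refine mul_le_mul_of_nonneg_right ?_ (dirichletForm_nonneg hK.nonneg a)
  exact (Finset.single_le_sum (f := P g) (fun g' _ => hP g g') (Finset.mem_univ g')).trans
    (Finset.single_le_sum (f := fun g => ∑ g', P g g')
      (fun g _ => Finset.sum_nonneg fun g' _ => hP g g') (Finset.mem_univ g))

variable [DecidableEq G]

/-- The matrix of the form `(a, b) ↦ dirichletForm W a b + (∑ a) (∑ b)`. -/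
def laplaceMatrix (W : G → G → ℝ) : Matrix G G ℝ :=
  Matrix.of fun i j => (if i = j then ∑ g, (W g i + W i g) else 0) - (W j i + W i j) + 1

/-- The solution of the Laplace equation with right-hand side `b`. -/
def potential (W : G → G → ℝ) (b : G → ℝ) : G → ℝ := (laplaceMatrix W)⁻¹.mulVec b

/-- The all-ones summand of the matrix removes the constants from the kernel of the graph Laplacian,
so that a genuine inverse can be used. -/
lemma sum_mul_laplaceMatrix_mulVec (W : G → G → ℝ) (a b : G → ℝ) :
    ∑ g, a g * (laplaceMatrix W).mulVec b g
      = dirichletForm W a b + (∑ g, a g) * ∑ g, b g := by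
  have h1 : ∀ g, (laplaceMatrix W).mulVec b g
      = ∑ g', (W g' g * (b g - b g') - W g g' * (b g' - b g)) + ∑ g', b g' := by
    intro g
    simp only [Matrix.mulVec, dotProduct, laplaceMatrix, Matrix.of_apply, sub_mul, add_mul, one_mul,
      Finset.sum_add_distrib, Finset.sum_sub_distrib, ite_mul, zero_mul, Finset.sum_ite_eq,
      Finset.mem_univ, if_true, mul_sub, ← Finset.sum_mul]
    ring
  have h2 : dirichletForm W a b = ∑ g, ∑ g', a g * (W g' g * (b g - b g'))
      - ∑ g, ∑ g', a g * (W g g' * (b g' - b g)) := by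
    rw [Finset.sum_comm (f := fun g g' => a g * (W g' g * (b g - b g'))), dirichletForm,
      ← Finset.sum_sub_distrib]
    refine Finset.sum_congr rfl fun g _ => ?_
    rw [← Finset.sum_sub_distrib]
    exact Finset.sum_congr rfl fun g' _ => by ring
  simp only [h1, h2, mul_add, Finset.sum_add_distrib, Finset.sum_sub_distrib, Finset.mul_sum,
    mul_sub, Finset.sum_mul]
  congr 1
  exact Finset.sum_comm

variable {K : G → G → ℝ}

/-- A kernel vector has zero Dirichlet form and zero sum. The Poincaré inequality makes it constant,
hence zero. -/
lemma det_laplaceMatrix_ne_zero (hK : IsConnectedWeightedGraph K) {W : G → G → ℝ} {c : ℝ}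
    (hc : 0 < c) (hW : ∀ g g', c * K g g' ≤ W g g') : (laplaceMatrix W).det ≠ 0 := by
  intro hdet
  obtain ⟨v, hv, hMv⟩ := Matrix.exists_mulVec_eq_zero_iff.2 hdet
  have hW0 : ∀ g g', 0 ≤ W g g' := fun g g' => (mul_nonneg hc.le (hK.nonneg g g')).trans (hW g g')
  have h1 := sum_mul_laplaceMatrix_mulVec W v v
  simp only [hMv, Pi.zero_apply, mul_zero, Finset.sum_const_zero] at h1
  have h2 := dirichletForm_nonneg hW0 v
  have h3 : (∑ g, v g) * ∑ g, v g = 0 := by nlinarith [mul_self_nonneg (∑ g, v g)]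
  have h4 : dirichletForm W v v = 0 := by linarith
  have h5 : dirichletForm K v v = 0 := by
    have := mul_dirichletForm_le hW v
    have := dirichletForm_nonneg hK.nonneg v
    nlinarith
  obtain ⟨P, -, hP⟩ := hK.exists_sq_sub_le
  have h6 : ∀ g g', v g' = v g := fun g g' => by
    have := hP v g g'
    rw [h5, mul_zero] at this
    exact sub_eq_zero.1 (pow_eq_zero_iff two_ne_zero |>.1 (le_antisymm this (sq_nonneg _)))
  refine hv (funext fun g => ?_)
  have h7 : ∑ g', v g' = Fintype.card G * v g := by
    rw [Finset.sum_congr rfl fun g' _ => h6 g g']; simp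
  have h8 : (Fintype.card G : ℝ) ≠ 0 := by
    exact_mod_cast (Fintype.card_pos_iff.2 ⟨g⟩).ne'
  rw [h7, mul_self_eq_zero, mul_eq_zero] at h3
  exact h3.resolve_left h8

lemma dirichletForm_potential (hK : IsConnectedWeightedGraph K) {W : G → G → ℝ} {c : ℝ}
    (hc : 0 < c) (hW : ∀ g g', c * K g g' ≤ W g g') {b : G → ℝ} (hb : ∑ g, b g = 0) (a : G → ℝ) :
    dirichletForm W a (potential W b) = ∑ g, a g * b g := by
  have hdet := det_laplaceMatrix_ne_zero hK hc hW
  have hM : (laplaceMatrix W).mulVec (potential W b) = b := by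
    rw [potential, Matrix.mulVec_mulVec, Matrix.mul_nonsing_inv _ (isUnit_iff_ne_zero.2 hdet),
      Matrix.one_mulVec]
  -- Testing with the constant 1 shows that the potential has zero sum, so the all-ones term drops
  -- out.
  have h1 := sum_mul_laplaceMatrix_mulVec W (fun _ => 1) (potential W b)
  have h2 := sum_mul_laplaceMatrix_mulVec W a (potential W b)
  simp only [hM, one_mul, hb, dirichletForm, sub_self, zero_mul, Finset.sum_const_zero,
    zero_add] at h1
  rw [hM] at h2
  rcases isEmpty_or_nonempty G with hG | hG
  · simp [dirichletForm]
  · have h3 : ∑ g, potential W b g = 0 := by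
      simpa using h1.symm
    rw [h2, h3, mul_zero, add_zero]

/-- The form equals $\sum_g\psi_g b_g$, at most $\sum_g|b_g|$ times the oscillation of $\psi$. The
Poincaré inequality bounds the oscillation by the square root of the form, and one factor of the
form cancels. -/
lemma dirichletForm_potential_le (hK : IsConnectedWeightedGraph K) {P : ℝ} (hP0 : 0 ≤ P)
    (hP : ∀ (a : G → ℝ) (g g' : G), (a g' - a g) ^ 2 ≤ P * dirichletForm K a a)
    {W : G → G → ℝ} {c : ℝ}
    (hc : 0 < c) (hW : ∀ g g', c * K g g' ≤ W g g') {b : G → ℝ} (hb : ∑ g, b g = 0) :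
    dirichletForm W (potential W b) (potential W b) ≤ (∑ g, |b g|) ^ 2 * P / c := by
  set ψ := potential W b with hψ
  have hW0 : ∀ g g', 0 ≤ W g g' := fun g g' => (mul_nonneg hc.le (hK.nonneg g g')).trans (hW g g')
  set D := dirichletForm W ψ ψ with hD
  have hD0 : 0 ≤ D := dirichletForm_nonneg hW0 ψ
  have hDK0 := dirichletForm_nonneg hK.nonneg ψ
  have hDK : c * dirichletForm K ψ ψ ≤ D := mul_dirichletForm_le hW ψ
  rcases isEmpty_or_nonempty G with hG | ⟨⟨g₀⟩⟩
  · simp [hD, dirichletForm]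
  -- Subtracting $\psi_{g_0}$ is free because $b$ sums to zero.
  have h1 : D = ∑ g, (ψ g - ψ g₀) * b g := by
    rw [hD, hψ, dirichletForm_potential hK hc hW hb]
    simp only [sub_mul, Finset.sum_sub_distrib, ← Finset.mul_sum, hb, mul_zero, sub_zero]
  set s := √(P * dirichletForm K ψ ψ) with hs
  have hs2 : s ^ 2 = P * dirichletForm K ψ ψ := Real.sq_sqrt (mul_nonneg hP0 hDK0)
  have h2 : D ≤ s * ∑ g, |b g| := by
    rw [h1, Finset.mul_sum]
    refine Finset.sum_le_sum fun g _ => (le_abs_self _).trans ?_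
    rw [abs_mul]
    exact mul_le_mul_of_nonneg_right (Real.abs_le_sqrt (hP ψ g₀ g)) (abs_nonneg _)
  have h3 : D ^ 2 ≤ (∑ g, |b g|) ^ 2 * P * dirichletForm K ψ ψ := by
    calc D ^ 2 ≤ (s * ∑ g, |b g|) ^ 2 := pow_le_pow_left₀ hD0 h2 2
      _ = _ := by rw [mul_pow, hs2]; ring
  rw [le_div_iff₀ hc]
  rcases hD0.eq_or_lt with h0 | h0
  · rw [← h0, zero_mul]; positivity
  · refine le_of_mul_le_mul_left ?_ h0
    have h4 : 0 ≤ (∑ g, |b g|) ^ 2 * P := by positivity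
    calc D * (D * c) = c * D ^ 2 := by ring
      _ ≤ c * ((∑ g, |b g|) ^ 2 * P * dirichletForm K ψ ψ) := by gcongr
      _ = (∑ g, |b g|) ^ 2 * P * (c * dirichletForm K ψ ψ) := by ring
      _ ≤ (∑ g, |b g|) ^ 2 * P * D := by gcongr
      _ = D * ((∑ g, |b g|) ^ 2 * P) := by ring

lemma measurable_det {X : Type*} [MeasurableSpace X] {A : X → Matrix G G ℝ}
    (hA : ∀ i j, Measurable fun x => A x i j) : Measurable fun x => (A x).det := by
  simp only [Matrix.det_apply']
  exact Finset.measurable_sum _ fun σ _ =>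
    (Finset.measurable_prod _ fun i _ => hA _ _).const_mul _

lemma measurable_inv_apply {X : Type*} [MeasurableSpace X] {A : X → Matrix G G ℝ}
    (hA : ∀ i j, Measurable fun x => A x i j) (i j : G) : Measurable fun x => (A x)⁻¹ i j := by
  simp only [Matrix.inv_def, Ring.inverse_eq_inv', Matrix.smul_apply, smul_eq_mul,
    Matrix.adjugate_apply]
  refine (measurable_det hA).inv.mul (measurable_det fun k l => ?_)
  by_cases hk : k = j
  · subst hk; simp
  · simpa [Matrix.updateRow_apply, hk] using hA k l

/-- The explicit inverse pays off here: by Cramer's rule its entries are quotients of polynomials in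
the weights, so no measurable selection of solutions is needed. -/
lemma measurable_potential {X : Type*} [MeasurableSpace X] {W : X → G → G → ℝ} {b : X → G → ℝ}
    (hW : ∀ g g', Measurable fun x => W x g g') (hb : ∀ g, Measurable fun x => b x g) (g : G) :
    Measurable fun x => potential (W x) (b x) g := by
  simp only [potential, Matrix.mulVec, dotProduct]
  refine Finset.measurable_sum _ fun j _ => (measurable_inv_apply (fun i j => ?_) g j).mul (hb j)
  simp only [laplaceMatrix, Matrix.of_apply]
  refine Measurable.add_const (Measurable.sub ?_ ((hW j i).add (hW i j))) _
  by_cases h : i = j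
  · simp only [h, if_true]
    exact Finset.measurable_sum _ fun g _ => (hW _ _).add (hW _ _)
  · simp only [h, if_false]; exact measurable_const

end Laplacian

/-! ### Paths of weights -/

section Weights

variable {G : Type*} [Fintype G] [Nonempty G]

/-- The uniform weights. -/
def uniformWeights : stdSimplex ℝ G :=
  ⟨fun _ => (Fintype.card G : ℝ)⁻¹, fun _ => by positivity, by simp⟩

/-- The path of weights `(1 - t²) p + t² u`, where `u` is uniform. -/
def weightPath (p : stdSimplex ℝ G) (t : ℝ) : stdSimplex ℝ G :=
  ⟨fun g => (1 - min (t ^ 2) 1) * p.1 g + min (t ^ 2) 1 * (uniformWeights (G := G)).1 g, by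
    have h0 : 0 ≤ min (t ^ 2) 1 := le_min (sq_nonneg t) zero_le_one
    have h1 : 0 ≤ 1 - min (t ^ 2) 1 := sub_nonneg.2 (min_le_right _ _)
    refine ⟨fun g => add_nonneg (mul_nonneg h1 (p.2.1 g))
      (mul_nonneg h0 (uniformWeights.2.1 g)), ?_⟩
    rw [Finset.sum_add_distrib, ← Finset.mul_sum, ← Finset.mul_sum, p.2.2,
      (uniformWeights (G := G)).2.2]
    ring⟩

lemma weightPath_zero (p : stdSimplex ℝ G) : weightPath p 0 = p :=
  Subtype.ext (by funext g; simp [weightPath])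

lemma weightPath_one (p : stdSimplex ℝ G) : weightPath p 1 = uniformWeights :=
  Subtype.ext (by funext g; simp [weightPath])

/-- The truncation in `weightPath` only keeps the weights in the simplex at all real times; it is
inactive on $[0,1]$. -/
lemma weightPath_apply (p : stdSimplex ℝ G) {t : ℝ} (ht : t ∈ Icc (0 : ℝ) 1) (g : G) :
    (weightPath p t).1 g = p.1 g + t ^ 2 * ((uniformWeights (G := G)).1 g - p.1 g) := by
  have : min (t ^ 2) 1 = t ^ 2 := min_eq_left (pow_le_one₀ ht.1 ht.2)
  simp only [weightPath, this]
  ring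

/-- The reason for $t^2$: the masses are at least of order $t^2$ while their time derivatives are of
order $t$, and the ratio (derivative)²/mass stays bounded. -/
lemma le_weightPath_apply (p : stdSimplex ℝ G) {t : ℝ} (ht : t ∈ Icc (0 : ℝ) 1)
    (g : G) : t ^ 2 * (Fintype.card G : ℝ)⁻¹ ≤ (weightPath p t).1 g := by
  rw [weightPath_apply p ht]
  have h1 : 0 ≤ (1 - t ^ 2) * p.1 g :=
    mul_nonneg (sub_nonneg.2 (pow_le_one₀ ht.1 ht.2)) (p.2.1 g)
  simp only [uniformWeights]
  linarith

end Weights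

/-! ### Product measures -/

section Product

variable {d : ℕ} {G : Type*} [Fintype G] [MeasurableSpace G]

/-- The measure on `G` with weights `p`. -/
def weightMeasure (p : G → ℝ) : Measure G := ∑ g, ENNReal.ofReal (p g) • Measure.dirac g

lemma isProbabilityMeasure_weightMeasure {p : G → ℝ} (hp : p ∈ stdSimplex ℝ G) :
    IsProbabilityMeasure (weightMeasure p) := by
  refine ⟨?_⟩
  simp only [weightMeasure, Measure.finsetSum_apply, Measure.smul_apply, measure_univ, smul_eq_mul,
    mul_one]
  rw [← ENNReal.ofReal_sum_of_nonneg fun g _ => hp.1 g, hp.2, ENNReal.ofReal_one]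

variable [DiscreteMeasurableSpace G]

lemma weightMeasure_singleton (p : G → ℝ) (g : G) :
    weightMeasure p {g} = ENNReal.ofReal (p g) := by
  classical
  simp [weightMeasure, Measure.finsetSum_apply, Set.indicator_apply]

lemma weightMeasure_real_singleton {p : G → ℝ} (hp : p ∈ stdSimplex ℝ G) (g : G) :
    (weightMeasure p).real {g} = p g := by
  rw [measureReal_def, weightMeasure_singleton, ENNReal.toReal_ofReal (hp.1 g)]

lemma weightMeasure_real (m : Measure G) [IsProbabilityMeasure m] :
    weightMeasure (fun g => m.real {g}) = m := by
  refine Measure.ext_of_singleton fun g => ?_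
  rw [weightMeasure_singleton, ofReal_measureReal]

lemma real_mem_stdSimplex (m : Measure G) [IsProbabilityMeasure m] :
    (fun g => m.real {g}) ∈ stdSimplex ℝ G := by
  refine ⟨fun g => measureReal_nonneg, ?_⟩
  simp

/-- The product of `ρ` with the measure on `G` with weights `p`. -/
def prodP2 (ρ : Measure (Euc d)) [IsProbabilityMeasure ρ] (hρ : ∫⁻ x, ‖x‖ₑ ^ 2 ∂ρ < ⊤)
    (p : stdSimplex ℝ G) : P2 d G :=
  ⟨ρ.prod (weightMeasure p.1), by
    have := isProbabilityMeasure_weightMeasure p.2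
    refine ⟨inferInstance, ?_⟩
    rw [lintegral_prod _ ((measurable_fst.enorm).pow_const 2).aemeasurable]
    simpa using hρ⟩

variable {ρ : Measure (Euc d)} [IsProbabilityMeasure ρ] (hρ : ∫⁻ x, ‖x‖ₑ ^ 2 ∂ρ < ⊤)

lemma IsTest.integral_prodP2 {ζ : Euc d → G → ℝ} (hζ : IsTest ζ) (p : stdSimplex ℝ G) :
    ∫ q, ζ q.1 q.2 ∂(prodP2 ρ hρ p).1 = ∑ g, p.1 g * ∫ x, ζ x g ∂ρ := by
  have := isProbabilityMeasure_weightMeasure p.2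
  rw [prodP2, integral_prod_symm _ (hζ.integrable _), integral_fintype .of_finite]
  simp only [weightMeasure_real_singleton p.2, smul_eq_mul]

/-! ### Exchanging mass between the vertices -/

variable [Nonempty G] {K : G → G → ℝ} {θ : Euc d → G → G → ℝ → ℝ → ℝ}

/-- If all `μ̂` of the path `ρ ⊗ p_t` have densities bounded below by `c t²` on a compact set `B`
with respect to a measure `l` whose restriction to `B` is proportional to `ρ`, then the mass can be
made uniform over `G` at finite cost. -/
lemma W2sq_prodP2_uniformWeights_lt_top (hK : IsConnectedWeightedGraph K)
    (hA : AssumptionA0 θ ∨ AssumptionA1A5 θ) {l : Measure (Euc d)} {B : Set (Euc d)}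
    (hB : IsCompact B) {κ : ℝ≥0} (hρl : ρ = (κ : ℝ≥0∞) • l.restrict B) (p : stdSimplex ℝ G)
    {a : ℝ → Euc d → G → G → ℝ}
    (ha : ∀ g g', Measurable fun q : ℝ × Euc d => a q.1 q.2 g g') (ha0 : ∀ t x g g', 0 ≤ a t x g g')
    (hat_eq : ∀ t g g', hat θ (prodP2 ρ hρ (weightPath p t)) g g'
      = l.withDensity fun x => ENNReal.ofReal (a t x g g'))
    {c : ℝ} (hc : 0 < c) (hca : ∀ t ∈ Icc (0 : ℝ) 1, ∀ x ∈ B, ∀ g g', c * t ^ 2 ≤ a t x g g') :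
    W2sq K θ (prodP2 ρ hρ p) (prodP2 ρ hρ uniformWeights) < ⊤ := by
  classical
  obtain ⟨P, hP0, hP⟩ := hK.exists_sq_sub_le
  set δ : G → ℝ := fun g => (uniformWeights (G := G)).1 g - p.1 g with hδ
  -- The source is the time derivative $2t\delta$ of the weights times $\kappa$, the density of
  -- $\rho$ with respect to $l$ on $B$.
  set b : ℝ → G → ℝ := fun t g => t * (2 * κ * δ g) with hb
  set W : ℝ → Euc d → G → G → ℝ := fun t x g g' => K g g' * a t x g g' with hW
  -- For each $x\in B$ this solves the Laplace equation with conductances $K\cdot a$; off $B$ there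
  -- is nothing to move.
  set ψ : ℝ → Euc d → G → ℝ := fun t x g => B.indicator (fun x => potential (W t x) (b t) g) x
    with hψ
  set E₀ : ℝ := (∑ g, |2 * κ * δ g|) ^ 2 * P / c with hE₀
  have hlB : l B < ⊤ := by
    have h1 : ρ univ = 1 := measure_univ
    rw [hρl, Measure.smul_apply, Measure.restrict_apply_univ, smul_eq_mul] at h1
    refine lt_top_iff_ne_top.2 fun h => ?_
    rw [h] at h1
    rcases eq_or_ne κ 0 with h0 | h0
    · simp [h0] at h1
    · rw [ENNReal.mul_top (by exact_mod_cast h0)] at h1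
      exact ENNReal.top_ne_one h1
  have hb0 : ∀ t, ∑ g, b t g = 0 := fun t => by
    simp only [hb, ← Finset.mul_sum, hδ, Finset.sum_sub_distrib, (uniformWeights (G := G)).2.2,
      p.2.2, sub_self, mul_zero]
  have hW0 : ∀ t x g g', 0 ≤ W t x g g' := fun t x g g' => mul_nonneg (hK.nonneg g g') (ha0 t x g g')
  have hWc : ∀ t ∈ Icc (0 : ℝ) 1, ∀ x ∈ B, ∀ g g', c * t ^ 2 * K g g' ≤ W t x g g' :=
    fun t ht x hx g g' => by
      rw [mul_comm]
      exact mul_le_mul_of_nonneg_left (hca t ht x hx g g') (hK.nonneg g g')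
  have hψB : ∀ t, ∀ x ∈ B, ψ t x = potential (W t x) (b t) := fun t x hx => by
    funext g; simp only [hψ, indicator_of_mem hx]
  have hgψ : ∀ t, ∀ x ∉ B, ∀ g g', gradG (ψ t) x g g' = 0 := fun t x hx g g' => by
    simp only [gradG, hψ, indicator_of_notMem hx, sub_self]
  have hψm : ∀ g, Measurable fun q : ℝ × Euc d => ψ q.1 q.2 g := fun g => by
    have h1 : Measurable fun q : ℝ × Euc d => potential (W q.1 q.2) (b q.1) g :=
      measurable_potential (fun g g' => (ha g g').const_mul _)
        (fun g => measurable_fst.mul_const _) g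
    exact h1.indicator (measurable_snd hB.measurableSet)
  clear_value ψ
  have hgm : ∀ g g', Measurable fun q : ℝ × Euc d => gradG (ψ q.1) q.2 g g' := fun g g' => by
    simp only [gradG]
    exact (hψm g').sub (hψm g)
  have hgm' : ∀ t g g', Measurable fun x => gradG (ψ t) x g g' := fun t g g' =>
    (hgm g g').comp (measurable_prodMk_left (x := t))
  have ham : ∀ t g g', Measurable fun x => a t x g g' := fun t g g' =>
    (ha g g').comp (measurable_prodMk_left (x := t))
  -- The source squared carries $t^2$ and the lower bound on the conductances carries $ct^2$, so the
  -- bound is free of $t$. Time 0 is left out because the lower bound degenerates there.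
  have hen : ∀ t ∈ Ioc (0 : ℝ) 1, ∀ x ∈ B, ∀ g g', gradG (ψ t) x g g' ^ 2 * W t x g g' ≤ E₀ := by
    intro t ht x hx g g'
    have hct : 0 < c * t ^ 2 := mul_pos hc (pow_pos ht.1 2)
    have h1 := sq_mul_le_dirichletForm (hW0 t x) (ψ t x) g g'
    refine h1.trans ?_
    rw [hψB t x hx]
    refine (dirichletForm_potential_le hK hP0 hP hct
      (hWc t (Ioc_subset_Icc_self ht) x hx) (hb0 t)).trans (le_of_eq ?_)
    simp only [hb, abs_mul t, ← Finset.mul_sum, abs_of_pos ht.1, hE₀]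
    have := ht.1.ne'
    field_simp
  have hlint : ∀ t ∈ Ioc (0 : ℝ) 1, ∀ g g',
      ∫⁻ x, ENNReal.ofReal (gradG (ψ t) x g g' ^ 2 * K g g')
        ∂(hat θ (prodP2 ρ hρ (weightPath p t)) g g') ≤ ENNReal.ofReal E₀ * l B := by
    intro t ht g g'
    rw [hat_eq, lintegral_withDensity_eq_lintegral_mul _ (ham t g g').ennreal_ofReal
      (((hgm' t g g').pow_const 2).mul_const _).ennreal_ofReal, ← setLIntegral_const,
      ← lintegral_indicator hB.measurableSet]
    refine lintegral_mono fun x => ?_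
    simp only [Pi.mul_apply]
    by_cases hx : x ∈ B
    · rw [indicator_of_mem hx, ← ENNReal.ofReal_mul (ha0 t x g g')]
      refine ENNReal.ofReal_le_ofReal ((le_of_eq ?_).trans (hen t ht x hx g g'))
      simp only [hW]; ring
    · simp [hgψ t x hx]
  have hfin : ENNReal.ofReal E₀ * l B < ⊤ := ENNReal.mul_lt_top ENNReal.ofReal_lt_top hlB
  have hinth : ∀ ζ : Euc d → G → ℝ, IsTest ζ → ∀ t ∈ Ioc (0 : ℝ) 1, ∀ g g',
      Integrable (fun x => gradG ζ x g g' * gradG (ψ t) x g g' * K g g')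
        (hat θ (prodP2 ρ hρ (weightPath p t)) g g') := by
    intro ζ hζ t ht g g'
    obtain ⟨Z, -, -, hZ, -⟩ := hζ.exists_abs_gradG_le
    obtain ⟨M, hM⟩ := exists_hat_le (θ := θ) hA hB
    have i1 : Integrable (fun x => gradG (ψ t) x g g' ^ 2 * K g g')
        (hat θ (prodP2 ρ hρ (weightPath p t)) g g') :=
      (lintegral_ofReal_ne_top_iff_integrable
        (((hgm' t g g').pow_const 2).mul_const _).aestronglyMeasurable
        (ae_of_all _ fun x => mul_nonneg (sq_nonneg _) (hK.nonneg g g'))).1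
        ((hlint t ht g g').trans_lt hfin).ne
    have i2 : Integrable (B.indicator fun _ => K g g')
        (hat θ (prodP2 ρ hρ (weightPath p t)) g g') :=
      (integrable_indicator_iff hB.measurableSet).2
        (integrableOn_const ((hM _ g g').trans_lt ENNReal.coe_lt_top).ne)
    refine ((i1.add i2).const_mul Z).mono'
      (((hζ.measurable_gradG g g').mul (hgm' t g g')).mul_const _).aestronglyMeasurable
      (ae_of_all _ fun x => ?_)
    have hK0 := hK.nonneg g g'
    rw [norm_mul, norm_mul, Real.norm_eq_abs, Real.norm_eq_abs, Real.norm_of_nonneg hK0]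
    simp only [Pi.add_apply]
    by_cases hx : x ∈ B
    · rw [indicator_of_mem hx, mul_assoc]
      refine mul_le_mul (hZ x g g') ?_ (by positivity) ((abs_nonneg _).trans (hZ x g g'))
      -- This is $|y|\le y^2+1$ multiplied by $K(g,g')$.
      nlinarith [sq_abs (gradG (ψ t) x g g'), sq_nonneg (|gradG (ψ t) x g g'| - 1),
        mul_nonneg hK0 (sq_nonneg (|gradG (ψ t) x g g'| - 1)),
        mul_nonneg hK0 (abs_nonneg (gradG (ψ t) x g g'))]
    · simp [hgψ t x hx, indicator_of_notMem hx]
  have hx0 : gradX (fun (_ : Euc d) (_ : G) => (0 : ℝ)) = fun _ _ => 0 := by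
    funext x g; simp [gradX, gradient]
  have hrhs : ∀ ζ : Euc d → G → ℝ, IsTest ζ → ∀ t ∈ Ioc (0 : ℝ) 1,
      ceRHS K θ (prodP2 ρ hρ (weightPath p t)) (gradX fun _ _ => 0) (gradG (ψ t)) ζ
        = 2 * t * ∑ g, δ g * ∫ x, ζ x g ∂ρ := by
    intro ζ hζ t ht
    have h1 : ∀ g g', Integrable (fun x => (gradG ζ x g g' * gradG (ψ t) x g g') * W t x g g') l ∧
        ∫ x, gradG ζ x g g' * gradG (ψ t) x g g' * K g g'
          ∂(hat θ (prodP2 ρ hρ (weightPath p t)) g g')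
        = ∫ x, (gradG ζ x g g' * gradG (ψ t) x g g') * W t x g g' ∂l := by
      intro g g'
      have h2 := hinth ζ hζ t ht g g'
      have h3 : ∀ x, (ENNReal.ofReal (a t x g g')).toReal •
          (gradG ζ x g g' * gradG (ψ t) x g g' * K g g')
          = (gradG ζ x g g' * gradG (ψ t) x g g') * W t x g g' := fun x => by
        rw [ENNReal.toReal_ofReal (ha0 t x g g'), smul_eq_mul]; simp only [hW]; ring
      rw [hat_eq, integrable_withDensity_iff_integrable_smul' (ham t g g').ennreal_ofReal
        (ae_of_all _ fun _ => ENNReal.ofReal_lt_top)] at h2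
      rw [hat_eq, integral_withDensity_eq_integral_toReal_smul (ham t g g').ennreal_ofReal
        (ae_of_all _ fun _ => ENNReal.ofReal_lt_top)]
      simp only [h3] at h2 ⊢
      exact ⟨h2, trivial⟩
    -- The weak Laplace equation at fixed $x$, tested with $\zeta(x,\cdot)$.
    have h4 : ∀ x, ∑ g, ∑ g', (gradG ζ x g g' * gradG (ψ t) x g g') * W t x g g'
        = B.indicator (fun x => ∑ g, ζ x g * b t g) x := by
      intro x
      by_cases hx : x ∈ B
      · rw [indicator_of_mem hx, ← dirichletForm_potential hK (mul_pos hc (pow_pos ht.1 2))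
          (hWc t (Ioc_subset_Icc_self ht) x hx) (hb0 t), ← hψB t x hx]
        rfl
      · simp [hgψ t x hx, indicator_of_notMem hx]
    have h5 : ∀ g, Integrable (fun x => ζ x g) (l.restrict B) := fun g => by
      have : IsFiniteMeasure (l.restrict B) := ⟨by rwa [Measure.restrict_apply_univ]⟩
      obtain ⟨Z, hZ⟩ := hζ.exists_abs_le
      exact Integrable.of_bound (hζ.smooth g).continuous.aestronglyMeasurable Z
        (ae_of_all _ fun x => hZ x g)
    have h6 : ∀ g, ∫ x, ζ x g ∂ρ = κ * ∫ x in B, ζ x g ∂l := fun g => by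
      rw [hρl, integral_smul_measure, ENNReal.coe_toReal, smul_eq_mul]
    calc ceRHS K θ (prodP2 ρ hρ (weightPath p t)) (gradX fun _ _ => 0) (gradG (ψ t)) ζ
        = ∑ g, ∑ g', ∫ x, (gradG ζ x g g' * gradG (ψ t) x g g') * W t x g g' ∂l := by
          rw [ceRHS, hx0]
          simp only [inner_zero_right, integral_zero, zero_add, (h1 _ _).2]
      _ = ∫ x, ∑ g, ∑ g', (gradG ζ x g g' * gradG (ψ t) x g g') * W t x g g' ∂l := by
          rw [integral_finsetSum _ fun g _ => integrable_finsetSum _ fun g' _ => (h1 g g').1]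
          exact Finset.sum_congr rfl fun g _ =>
            (integral_finsetSum _ fun g' _ => (h1 g g').1).symm
      _ = ∫ x in B, ∑ g, ζ x g * b t g ∂l := by
          simp only [h4]
          exact integral_indicator hB.measurableSet
      _ = ∑ g, b t g * ∫ x in B, ζ x g ∂l := by
          rw [integral_finsetSum _ fun g _ => (h5 g).mul_const _]
          exact Finset.sum_congr rfl fun g _ => by rw [integral_mul_const, mul_comm]
      _ = _ := by
          rw [Finset.mul_sum]
          refine Finset.sum_congr rfl fun g _ => ?_
          rw [h6]; simp only [hb]; ring
  have hsolves : SolvesOn K θ 0 1 (fun t => prodP2 ρ hρ (weightPath p t)) (fun _ _ _ => 0) ψ := by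
    have hae : ∀ᵐ t : ℝ, t ∈ Icc (0 : ℝ) 1 → t ∈ Ioc (0 : ℝ) 1 := by
      filter_upwards [Measure.ae_ne volume (0 : ℝ)] with t ht hmem using
        ⟨lt_of_le_of_ne hmem.1 (Ne.symm ht), hmem.2⟩
    constructor
    · intro t g; exact differentiable_const _
    · intro g; simp only [hx0]; exact measurable_const
    · exact hgm
    · intro ζ hζ
      refine ae_of_all _ fun t _ => ?_
      simp only [hx0, inner_zero_right]
      exact integrable_zero _ _ _
    · intro ζ hζ
      filter_upwards [hae] with t ht hmem using hinth ζ hζ t (ht hmem)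
    · intro ζ hζ
      have h1 : IntegrableOn (fun t : ℝ => 2 * t * ∑ g, δ g * ∫ x, ζ x g ∂ρ) (Icc 0 1) :=
        (by fun_prop : Continuous fun t : ℝ =>
          2 * t * ∑ g, δ g * ∫ x, ζ x g ∂ρ).continuousOn.integrableOn_compact isCompact_Icc
      refine h1.congr ?_
      rw [Filter.EventuallyEq, ae_restrict_iff' measurableSet_Icc]
      filter_upwards [hae] with t ht hmem using (hrhs ζ hζ t (ht hmem)).symm
    · intro ζ hζ s hs t ht
      have h1 : ∫ r in s..t, ceRHS K θ (prodP2 ρ hρ (weightPath p r)) (gradX fun _ _ => 0)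
          (gradG (ψ r)) ζ = ∫ r in s..t, 2 * r * ∑ g, δ g * ∫ x, ζ x g ∂ρ := by
        refine intervalIntegral.integral_congr_ae (hae.mono fun r hr hmem => ?_)
        exact hrhs ζ hζ r
          (hr (ordConnected_Icc.uIcc_subset hs ht (uIoc_subset_uIcc hmem)))
      rw [h1, intervalIntegral.integral_mul_const, intervalIntegral.integral_const_mul,
        integral_id, hζ.integral_prodP2, hζ.integral_prodP2]
      simp only [weightPath_apply p hs, weightPath_apply p ht]
      rw [← Finset.sum_sub_distrib, Finset.mul_sum]
      refine Finset.sum_congr rfl fun g _ => ?_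
      simp only [hδ]; ring
  have h1 := hsolves.W2sq_le
  rw [weightPath_zero, weightPath_one] at h1
  refine h1.trans_lt ?_
  have hE : ∀ t ∈ Ioc (0 : ℝ) 1, energyDensity K θ (prodP2 ρ hρ (weightPath p t))
      (gradX fun _ _ => 0) (gradG (ψ t)) ≤ ∑ _g : G, ∑ _g' : G, ENNReal.ofReal E₀ * l B := by
    intro t ht
    rw [energyDensity, hx0]
    simp only [enorm_zero, ne_eq, OfNat.ofNat_ne_zero, not_false_eq_true, zero_pow, lintegral_zero,
      zero_add]
    exact Finset.sum_le_sum fun g _ => Finset.sum_le_sum fun g' _ => hlint t ht g g'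
  rw [energyOn, ← setLIntegral_congr Ioc_ae_eq_Icc]
  refine (setLIntegral_mono' measurableSet_Ioc hE).trans_lt ?_
  rw [setLIntegral_const, Real.volume_Ioc, sub_zero, ENNReal.ofReal_one, mul_one]
  exact ENNReal.sum_lt_top.2 fun g _ => ENNReal.sum_lt_top.2 fun g' _ => hfin

/-- A product disintegrates with a constant kernel, and disintegrations are unique almost
everywhere. -/
lemma condKernel_prodP2 (p : stdSimplex ℝ G) :
    ∀ᵐ x ∂ρ, (prodP2 ρ hρ p).1.condKernel x = weightMeasure p.1 := by
  have := isProbabilityMeasure_weightMeasure p.2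
  have hfst : (prodP2 ρ hρ p).1.fst = ρ := by simp [prodP2]
  have h := ProbabilityTheory.eq_condKernel_of_measure_eq_compProd (ρ := (prodP2 ρ hρ p).1)
    (ProbabilityTheory.Kernel.const (Euc d) (weightMeasure p.1)) (by
      rw [hfst, Measure.compProd_const]; rfl)
  rw [hfst] at h
  filter_upwards [h] with x hx
  rw [← hx, ProbabilityTheory.Kernel.const_apply]

lemma hat_prodP2 (hm : ¬ MassIndependent θ) (p : stdSimplex ℝ G) (g g' : G) :
    hat θ (prodP2 ρ hρ p) g g'
      = ρ.withDensity fun x => ENNReal.ofReal (θ x g g' (p.1 g) (p.1 g')) := by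
  have := isProbabilityMeasure_weightMeasure p.2
  have hfst : (prodP2 ρ hρ p).1.fst = ρ := by simp [prodP2]
  rw [hat, if_neg hm, hfst]
  refine withDensity_congr_ae ?_
  filter_upwards [condKernel_prodP2 hρ p] with x hx
  rw [hx, weightMeasure_real_singleton p.2, weightMeasure_real_singleton p.2]

/-! ### Finiteness -/

/-- Under (A0) $\hat\mu$ has a Lebesgue density, so $\rho$ is normalised Lebesgue measure on the
unit ball. Under (A1)–(A5) $\hat\mu$ is carried by $\mu_x$, and a Dirac mass at the origin suffices.
-/
lemma exists_W2sq_prodP2_lt_top (hK : IsConnectedWeightedGraph K) (hθ : IsMobility θ)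
    (hA : AssumptionA0 θ ∨ AssumptionA1A5 θ) :
    ∃ (ρ : Measure (Euc d)) (_ : IsProbabilityMeasure ρ) (hρ : ∫⁻ x, ‖x‖ₑ ^ 2 ∂ρ < ⊤),
      ∀ p : stdSimplex ℝ G, W2sq K θ (prodP2 ρ hρ p) (prodP2 ρ hρ uniformWeights) < ⊤ := by
  have hA' := hA
  rcases hA with hA | hA
  · set B : Set (Euc d) := Metric.closedBall 0 1 with hBdef
    have hB : IsCompact B := isCompact_closedBall 0 1
    have hB0 : volume B ≠ 0 := (Metric.measure_closedBall_pos volume 0 one_pos).ne'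
    have hBt : volume B ≠ ⊤ := hB.measure_lt_top.ne
    set κ : ℝ≥0 := (volume B)⁻¹.toNNReal with hκ
    have hκ' : (κ : ℝ≥0∞) = (volume B)⁻¹ := ENNReal.coe_toNNReal (ENNReal.inv_ne_top.2 hB0)
    set ρ : Measure (Euc d) := (κ : ℝ≥0∞) • volume.restrict B with hρdef
    have hρp : IsProbabilityMeasure ρ := ⟨by
      rw [hρdef, Measure.smul_apply, Measure.restrict_apply_univ, smul_eq_mul, hκ',
        ENNReal.inv_mul_cancel hB0 hBt]⟩
    have hρ : ∫⁻ x, ‖x‖ₑ ^ 2 ∂ρ < ⊤ := by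
      rw [hρdef, lintegral_smul_measure, smul_eq_mul]
      refine ENNReal.mul_lt_top ENNReal.coe_lt_top ?_
      calc ∫⁻ x in B, ‖x‖ₑ ^ 2 ≤ ∫⁻ _ in B, 1 := by
            refine setLIntegral_mono' hB.measurableSet fun x hx => ?_
            refine pow_le_one₀ zero_le ?_
            rw [← ofReal_norm, ENNReal.ofReal_le_one]
            simpa [hBdef] using hx
        _ < ⊤ := by rw [setLIntegral_const, one_mul]; exact hB.measure_lt_top
    refine ⟨ρ, hρp, hρ, fun p => ?_⟩
    obtain ⟨c, hc, hcB⟩ := hA.boundedBelow B hB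
    refine W2sq_prodP2_uniformWeights_lt_top hρ hK hA' hB hρdef p
      (a := fun _ x g g' => θ x g g' 1 1) (fun g g' => ?_)
      (fun _ x g g' => hθ.nonneg x g g' 1 1 zero_le_one zero_le_one) (fun t g g' => ?_) hc
      (fun t ht x hx g g' => ?_)
    · have := (hθ.measurable g g').comp
        (measurable_snd.prodMk (measurable_const (a := ((1 : ℝ≥0), (1 : ℝ≥0)))) :
          Measurable fun q : ℝ × Euc d => (q.2, ((1 : ℝ≥0), (1 : ℝ≥0))))
      simpa [Function.comp_def] using this
    · rw [hat, if_pos hA.massIndependent]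
    · refine le_trans ?_ (hcB x hx g g')
      exact mul_le_of_le_one_right hc.le (pow_le_one₀ ht.1 ht.2)
  · have hρ : ∫⁻ x : Euc d, ‖x‖ₑ ^ 2 ∂(Measure.dirac 0) < ⊤ := by simp
    refine ⟨Measure.dirac 0, inferInstance, hρ, fun p => ?_⟩
    obtain ⟨c, hc, hcB⟩ := hA.boundedBelow {0} isCompact_singleton
    have hn : (0 : ℝ) < (Fintype.card G : ℝ)⁻¹ := by
      have : 0 < Fintype.card G := Fintype.card_pos
      positivity
    have hwm : ∀ g, Measurable fun t => (weightPath p t).1 g := fun g => by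
      simp only [weightPath]
      fun_prop
    refine W2sq_prodP2_uniformWeights_lt_top hρ hK hA' isCompact_singleton (κ := 1)
      (l := Measure.dirac 0) (B := {0}) (by simp) p
      (a := fun t x g g' => θ x g g' ((weightPath p t).1 g) ((weightPath p t).1 g'))
      (fun g g' => ?_)
      (fun t x g g' => hθ.nonneg x g g' _ _ ((weightPath p t).2.1 g) ((weightPath p t).2.1 g'))
      (fun t g g' => hat_prodP2 hρ hA.not_massIndependent _ g g')
      (c := (Fintype.card G : ℝ)⁻¹ * c) (by positivity) (fun t ht x hx g g' => ?_)
    · have := (hθ.measurable g g').comp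
        (measurable_snd.prodMk (((hwm g).comp measurable_fst).real_toNNReal.prodMk
          ((hwm g').comp measurable_fst).real_toNNReal) :
          Measurable fun q : ℝ × Euc d => (q.2, (((weightPath p q.1).1 g).toNNReal,
            ((weightPath p q.1).1 g').toNNReal)))
      convert this using 2 with q
      simp only [Function.comp_apply, Real.coe_toNNReal _ ((weightPath p q.1).2.1 _)]
    · have h1 := hA.mul_le (x := x) (g := g) (g' := g') (r := t ^ 2 * (Fintype.card G : ℝ)⁻¹)
        (by positivity) (le_weightPath_apply p ht g) (le_weightPath_apply p ht g')
      refine le_trans ?_ h1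
      calc (Fintype.card G : ℝ)⁻¹ * c * t ^ 2 = t ^ 2 * (Fintype.card G : ℝ)⁻¹ * c := by ring
        _ ≤ _ := by
          gcongr
          exact hcB x hx g g'

/-- Each measure is joined first to the product of $\rho$ with its own $G$-marginal, then to
$\rho\otimes u$ with $u$ uniform. -/
lemma W2sq_lt_top (hK : IsConnectedWeightedGraph K) (hθ : IsMobility θ)
    (hA : AssumptionA0 θ ∨ AssumptionA1A5 θ) (μ ν : P2 d G) : W2sq K θ μ ν < ⊤ := by
  obtain ⟨ρ, hρp, hρ, h⟩ := exists_W2sq_prodP2_lt_top (d := d) hK hθ hA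
  have key : ∀ μ : P2 d G, W2sq K θ μ (prodP2 ρ hρ uniformWeights) < ⊤ := fun μ => by
    refine W2sq_lt_top_trans ?_ (h ⟨_, real_mem_stdSimplex μ.1.snd⟩)
    refine W2sq_lt_top_of_snd_eq ?_
    have := isProbabilityMeasure_weightMeasure (real_mem_stdSimplex μ.1.snd)
    rw [prodP2, Measure.snd_prod, weightMeasure_real]
  exact W2sq_lt_top_trans (key μ) (by rw [W2sq_comm]; exact key ν)

end Product

end SemiDiscrete

end

theorem theorem2p1 {d : ℕ} {G : Type*} [Fintype G] [Nonempty G] [MeasurableSpace G]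
    [DiscreteMeasurableSpace G] (K : G → G → ℝ) (hK : SemiDiscrete.IsConnectedWeightedGraph K)
    (θ : SemiDiscrete.Euc d → G → G → ℝ → ℝ → ℝ) (hθ : SemiDiscrete.IsMobility θ)
    (hA : SemiDiscrete.AssumptionA0 θ ∨ SemiDiscrete.AssumptionA1A5 θ) :
    (∀ μ ν : SemiDiscrete.P2 d G, SemiDiscrete.W2 K θ μ ν < ⊤) ∧
    (∀ μ ν : SemiDiscrete.P2 d G, SemiDiscrete.W2 K θ μ ν = 0 ↔ μ = ν) ∧
    (∀ μ ν : SemiDiscrete.P2 d G, SemiDiscrete.W2 K θ μ ν = SemiDiscrete.W2 K θ ν μ) ∧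
    (∀ μ ν ρ : SemiDiscrete.P2 d G,
      SemiDiscrete.W2 K θ μ ρ ≤ SemiDiscrete.W2 K θ μ ν + SemiDiscrete.W2 K θ ν ρ) :=
  ⟨fun μ ν => SemiDiscrete.W2_lt_top_iff.2 (SemiDiscrete.W2sq_lt_top hK hθ hA μ ν),
    SemiDiscrete.W2_eq_zero_iff hK.nonneg hA,
    fun μ ν => by rw [SemiDiscrete.W2, SemiDiscrete.W2, SemiDiscrete.W2sq_comm],
    SemiDiscrete.W2_triangle⟩
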